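/- **Setting.** Let $R$ be a Noetherian unique factorization domain with $\tfrac12\in R$, let $p\ge 1$, $q\ge 3$ be integers, put $n=p+2$, and let $B_0,B_1,H$ be free $R$-modules of ranks $q-2$, $p+q$, $n$. Write $(-)^*=\operatorname{Hom}_R(-,R)$. Equip $H\oplus H^*$ with the quadratic form $Q(f,f')=f'(f)$ and with its pairing $\langle (f,f'),(g,g')\rangle=f'(g)+g'(f)$, which identifies $(H\oplus H^*)^*$ with $H\oplus H^*$. For an ideal $I$ let $\operatorname{grade} I=\inf\{i:\operatorname{Ext}^i_R(R/I,R)\ne 0\}$ (so $\operatorname{grade}(1)=\infty$). Let $$\mathbb B\colon\ 0\to B_0^*\xrightarrow{\delta_4=\delta_1^*}B_1^*\xrightarrow{\delta_3=\delta_2^*}H\oplus H^*\xrightarrow{\delta_2}B_1\xrightarrow{\delta_1}B_0$$ be acyclic (exact except possibly at $B_0$). Over $K=\operatorname{Frac}(R)$ the image of $\delta_3$ is a maximal isotropic subspace of $(H\oplus H^*)_K$; assume that it does not lie in the same component of the variety of maximal isotropic subspaces as $H^*_K$, i.e. $\dim_K(\operatorname{im}(\delta_3)_K\cap H^*_K)\not\equiv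 n \pmod 2$. **Spinor coordinates.** Let $V_{\mathrm{even}}=\bigwedge^{\mathrm{even}}H$ and $V_{\mathrm{odd}}=\bigwedge^{\mathrm{odd}}H$. Let $x=(f,f')\in H\oplus H^*$ act on $\bigwedge H$ by $x\cdot s=f\wedge s+f'\lrcorner s$, where $f'\lrcorner(e_1\wedge\dots\wedge e_j)=\sum_i(-1)^{i-1}f'(e_i)\,e_1\wedge\dots\wedge\hat e_i\wedge\dots\wedge e_j$; this extends to an action of the Clifford algebra of $Q$. Let $\beta(s,t)$ be the coefficient of $s^{\mathrm{t}}\wedge t$ in $\bigwedge^nH\cong R$, where $s^{\mathrm t}$ is the reversal of $s$, and let $\mathbf P\colon S_2(V_{\mathrm{odd}})\to\bigwedge^n(H\oplus H^*)$ be the map with $\langle \mathbf P(st),v_1\wedge\dots\wedge v_n\rangle=\beta(s,[v_1\cdots v_n]\cdot t)$, where $[v_1\cdots v_n]$ is the antisymmetrized Clifford product. Let $\mathbf a_3\in\bigwedge^n(H\oplus H^*)$ be the Buchsbaum–Eisenbud multiplier: with $\mathbf a_4\in\bigwedge^{q-2}B_1^*$ the image of a generator of $\bigwedge^{q-2}B_0^*$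 under $\bigwedge^{q-2}\delta_4$, one has $\bigwedge^n\delta_3(\xi)=(\xi\wedge\mathbf a_4)\,\mathbf a_3$ for all $\xi\in\bigwedge^nB_1^*$, where $\bigwedge^{p+q}B_1^*\cong R$. *Spinor coordinates* of $\mathbb B$ are an element $\tilde{\mathbf a}_3\in V_{\mathrm{odd}}$ such that $\mathbf P(\tilde{\mathbf a}_3^{\,2})=\mathbf a_3$ up to a unit of $R$. **Theorem.** Spinor coordinates of $\mathbb B$ exist. Let $\tilde{\mathbf a}_3$ be any choice of them. Then the dual $V_{\mathrm{even}}^*\to(H\oplus H^*)^*\cong H\oplus H^*$ of the map $x\mapsto x\cdot\tilde{\mathbf a}_3$ lifts along $\delta_3$ to a map $w\colon V_{\mathrm{even}}^*\to B_1^*$. For every such lift $w$, the maps $d_3=[\,\delta_4,\ w|_R\,]$ (with $R=\bigwedge^0H^*\subset V_{\mathrm{even}}^*$), $d_2=(\delta_2|_H)^*$ and $d_1=\tilde{\mathbf a}_3^*|_{H^*}$ (with $H^*\subset V_{\mathrm{odd}}^*$) form a complex $$\mathbb A\colon\ 0\to B_0^*\oplus R\xrightarrow{d_3}B_1^*\xrightarrow{d_2}H^*\xrightarrow{d_1}R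 .$$ Let $I$ be the ideal generated by the entries of $d_1$. If $\operatorname{grade} I\ge 3$, then $\mathbb A$ is acyclic (exact except possibly at the last term $R$), and either $\operatorname{grade} I=3$ or $I=(1)$. -/

import Mathlib

open scoped TensorProduct

noncomputable section

namespace SpinorRes

universe u

/-- The grade of an ideal: the least `i` with `Ext^i(R/I, R) ≠ 0`, and `⊤` if there is none. -/
def grade {R : Type u} [CommRing R] (I : Ideal R) : ℕ∞ :=
  sInf {g : ℕ∞ | ∃ i : ℕ, g = i ∧
    Nontrivial (CategoryTheory.Abelian.Ext.{u} (ModuleCat.of R (R ⧸ I)) (ModuleCat.of R R) i)}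

section Hyperbolic

variable (R H : Type*) [CommRing R] [AddCommGroup H] [Module R H]

/-- The module `H ⊕ H^*`, in the order `H^* × H` in which Mathlib defines the evaluation form:
its quadratic form is `QuadraticForm.dualProd R H : (f', f) ↦ f' f`, and the associated pairing
is `LinearMap.dualProd R H`. -/
abbrev Hyp : Type _ := Module.Dual R H × H

/-- The half-spinor module `⋀^even H`. -/
abbrev VEven : Submodule R (ExteriorAlgebra R H) :=
  CliffordAlgebra.evenOdd (0 : QuadraticForm R H) 0

/-- The half-spinor module `⋀^odd H`. -/
abbrev VOdd : Submodule R (ExteriorAlgebra R H) :=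
  CliffordAlgebra.evenOdd (0 : QuadraticForm R H) 1

/-- The action of `H ⊕ H^*` on `⋀ H`: the vector `(f', f)` sends `x` to `f ∧ x + f' ⌋ x`, where
`f' ⌋ (e₁ ∧ ⋯ ∧ eⱼ) = ∑ i, (-1)^(i-1) f'(eᵢ) e₁ ∧ ⋯ ∧ êᵢ ∧ ⋯ ∧ eⱼ`. -/
def spinorAct : Hyp R H →ₗ[R] Module.End R (ExteriorAlgebra R H) :=
  (LinearMap.mul R (ExteriorAlgebra R H)).comp
      ((ExteriorAlgebra.ι R).comp (LinearMap.snd R (Module.Dual R H) H)) +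
    (CliffordAlgebra.contractLeft (Q := (0 : QuadraticForm R H))).comp
      (LinearMap.fst R (Module.Dual R H) H)

variable {R H}

theorem spinorAct_apply (x : Hyp R H) (s : ExteriorAlgebra R H) :
    spinorAct R H x s = ExteriorAlgebra.ι R x.2 * s +
      CliffordAlgebra.contractLeft (Q := (0 : QuadraticForm R H)) x.1 s := rfl

theorem spinorAct_sq (x : Hyp R H) :
    spinorAct R H x * spinorAct R H x =
      algebraMap R (Module.End R (ExteriorAlgebra R H)) (QuadraticForm.dualProd R H x) := by
  refine LinearMap.ext fun s => ?_
  have h1 : ExteriorAlgebra.ι R x.2 * (ExteriorAlgebra.ι R x.2 * s) = 0 := by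
    rw [← mul_assoc, ExteriorAlgebra.ι_sq_zero, zero_mul]
  have h2 : CliffordAlgebra.contractLeft (Q := (0 : QuadraticForm R H)) x.1
      (ExteriorAlgebra.ι R x.2 * s) = x.1 x.2 • s - ExteriorAlgebra.ι R x.2 *
        CliffordAlgebra.contractLeft (Q := (0 : QuadraticForm R H)) x.1 s :=
    CliffordAlgebra.contractLeft_ι_mul x.1 x.2 s
  rw [Module.End.mul_apply, spinorAct_apply, spinorAct_apply, mul_add, map_add, h1, h2,
    CliffordAlgebra.contractLeft_contractLeft, Module.algebraMap_end_apply,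
    QuadraticForm.dualProd_apply]
  abel

theorem contractLeft_mem (d : Module.Dual R H) (i : ZMod 2) (s : ExteriorAlgebra R H)
    (hs : s ∈ CliffordAlgebra.evenOdd (0 : QuadraticForm R H) i) :
    CliffordAlgebra.contractLeft (Q := (0 : QuadraticForm R H)) d s ∈
      CliffordAlgebra.evenOdd (0 : QuadraticForm R H) (i + 1) := by
  have hodd : ∀ (m : H) (j : ZMod 2) (y : ExteriorAlgebra R H),
      y ∈ CliffordAlgebra.evenOdd (0 : QuadraticForm R H) j →
      CliffordAlgebra.ι (0 : QuadraticForm R H) m * y ∈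
        CliffordAlgebra.evenOdd (0 : QuadraticForm R H) (j + 1) := fun m j y hy => by
    rw [add_comm]
    exact CliffordAlgebra.evenOdd_mul_le _ 1 j
      (Submodule.mul_mem_mul (CliffordAlgebra.ι_mem_evenOdd_one _ m) hy)
  refine CliffordAlgebra.evenOdd_induction (0 : QuadraticForm R H) i
    (motive := fun s _ => CliffordAlgebra.contractLeft (Q := (0 : QuadraticForm R H)) d s ∈
      CliffordAlgebra.evenOdd (0 : QuadraticForm R H) (i + 1)) ?_ ?_ ?_ s hs
  · intro s h
    have hi : i = 0 ∨ i = 1 := by clear h hs; revert i; decide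
    rcases hi with rfl | rfl
    · obtain ⟨r, rfl⟩ := Submodule.mem_one.mp h
      rw [CliffordAlgebra.contractLeft_algebraMap]
      exact Submodule.zero_mem _
    · have h' : s ∈ LinearMap.range (CliffordAlgebra.ι (0 : QuadraticForm R H)) := by
        rw [← pow_one (LinearMap.range (CliffordAlgebra.ι (0 : QuadraticForm R H)))]
        exact h
      obtain ⟨m, rfl⟩ := h'
      rw [CliffordAlgebra.contractLeft_ι]
      exact CliffordAlgebra.one_le_evenOdd_zero _ (Submodule.algebraMap_mem _)
  · intro x y hx hy ihx ihy
    rw [map_add]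
    exact Submodule.add_mem _ ihx ihy
  · intro m₁ m₂ x hx ih
    have hij : i + 1 + 1 = i := by clear hx ih hs; revert i; decide
    rw [mul_assoc, CliffordAlgebra.contractLeft_ι_mul, CliffordAlgebra.contractLeft_ι_mul]
    refine Submodule.sub_mem _ (Submodule.smul_mem _ _ (hodd _ _ _ hx)) (hodd _ _ _ ?_)
    refine Submodule.sub_mem _ (Submodule.smul_mem _ _ hx) ?_
    have h2 := hodd m₂ _ _ ih
    rwa [hij] at h2

theorem spinorAct_mem_even (x : Hyp R H) (s : ExteriorAlgebra R H) (hs : s ∈ VOdd R H) :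
    spinorAct R H x s ∈ VEven R H := by
  rw [spinorAct_apply]
  refine Submodule.add_mem _ ?_ (contractLeft_mem x.1 1 s hs)
  exact CliffordAlgebra.evenOdd_mul_le (0 : QuadraticForm R H) 1 1
    (Submodule.mul_mem_mul (CliffordAlgebra.ι_mem_evenOdd_one _ x.2) hs)

/-- For a spinor `a ∈ ⋀^odd H`, the map `H ⊕ H^* → ⋀^even H`, `x ↦ x · a`. -/
def actOn (a : VOdd R H) : Hyp R H →ₗ[R] VEven R H :=
  LinearMap.codRestrict (VEven R H) ((spinorAct R H).flip (a : ExteriorAlgebra R H))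
    fun x => spinorAct_mem_even x a a.2

variable (R H) in
/-- The spin representation of the Clifford algebra of `H ⊕ H^*` on `⋀ H`. -/
def cliffordAct : CliffordAlgebra (QuadraticForm.dualProd R H) →ₐ[R]
    Module.End R (ExteriorAlgebra R H) :=
  CliffordAlgebra.lift (QuadraticForm.dualProd R H) ⟨spinorAct R H, spinorAct_sq⟩

/-- The coefficient of `e₁ ∧ ⋯ ∧ eₙ` of an element of `⋀ H`. -/
def topCoeff {n : ℕ} (e : Module.Basis (Fin n) R H) : ExteriorAlgebra R H →ₗ[R] R :=
  ExteriorAlgebra.liftAlternating (Pi.single n e.det)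

/-- The invariant bilinear form on spinors: `β(s, t)` is the top coefficient of `sᵗ ∧ t`, where
`sᵗ` is the reversal `(e₁ ∧ ⋯ ∧ eⱼ)ᵗ = eⱼ ∧ ⋯ ∧ e₁`.  One has `β(x · s, t) = β(s, x · t)` for
all `x ∈ H ⊕ H^*`. -/
def spinorForm {n : ℕ} (e : Module.Basis (Fin n) R H) :
    ExteriorAlgebra R H →ₗ[R] ExteriorAlgebra R H →ₗ[R] R :=
  ((LinearMap.mul R (ExteriorAlgebra R H)).compr₂ (topCoeff e)).comp
    (CliffordAlgebra.reverse (Q := (0 : QuadraticForm R H)))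

/-- The identification of `⋀ⁿ (H ⊕ H^*)` with its dual that is induced by the pairing of
`H ⊕ H^*`:  `⟨x₁ ∧ ⋯ ∧ xₙ, v₁ ∧ ⋯ ∧ vₙ⟩ = det ⟨xᵢ, vⱼ⟩`. -/
def wedgePairing (R H : Type*) [CommRing R] [AddCommGroup H] [Module R H] (n : ℕ) :
    ⋀[R]^n (Hyp R H) →ₗ[R] Module.Dual R (⋀[R]^n (Hyp R H)) :=
  (exteriorPower.pairingDual R (Hyp R H) n).comp (exteriorPower.map n (LinearMap.dualProd R H))

/-- The equivariant symmetric map `S₂(⋀^odd H) → ⋀ⁿ (H ⊕ H^*)`, whose value at `s · t` is here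
given as a functional on `⋀ⁿ (H ⊕ H^*)` (see `wedgePairing`):
`v₁ ∧ ⋯ ∧ vₙ ↦ β(s, [v₁ ⋯ vₙ] t)`, where `[v₁ ⋯ vₙ]` is the antisymmetrized Clifford product,
acting on `⋀ H` by the spin representation. -/
def spinorP [Invertible (2 : R)] {n : ℕ} (e : Module.Basis (Fin n) R H)
    (s t : ExteriorAlgebra R H) : Module.Dual R (⋀[R]^n (Hyp R H)) :=
  (spinorForm e s).comp <|
    ((cliffordAct R H).toLinearMap.flip t).comp <|
      (CliffordAlgebra.equivExterior (QuadraticForm.dualProd R H)).symm.toLinearMap.comp <|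
        (⋀[R]^n (Hyp R H)).subtype

end Hyperbolic

/-- Two maximal isotropic subspaces of a split quadratic space of dimension `2n` over a field lie
in different components of the variety of maximal isotropic subspaces: the dimension of their
intersection does not have the parity of `n`. -/
def OppositeComponents {K V : Type*} [Field K] [AddCommGroup V] [Module K V] (n : ℕ)
    (L L' : Submodule K V) : Prop :=
  ¬ Module.finrank K (L ⊓ L' : Submodule K V) ≡ n [MOD 2]

section Resolution

variable {R B₀ B₁ H : Type*} [CommRing R]
  [AddCommGroup B₀] [Module R B₀] [AddCommGroup B₁] [Module R B₁]
  [AddCommGroup H] [Module R H] [Module.Free R H] [Module.Finite R H]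

/-- `δ₄ = δ₁^* : B₀^* → B₁^*`. -/
def delta4 (δ₁ : B₁ →ₗ[R] B₀) : Module.Dual R B₀ →ₗ[R] Module.Dual R B₁ := δ₁.dualMap

/-- `δ₃ = δ₂^* : B₁^* → (H ⊕ H^*)^* ≅ H ⊕ H^*`, so that `⟨δ₃ φ, x⟩ = φ (δ₂ x)`. -/
def delta3 (δ₂ : Hyp R H →ₗ[R] B₁) : Module.Dual R B₁ →ₗ[R] Hyp R H :=
  (δ₂.comp (LinearMap.inr R (Module.Dual R H) H)).dualMap.prod
    ((Module.evalEquiv R H).symm.toLinearMap.comp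
      (δ₂.comp (LinearMap.inl R (Module.Dual R H) H)).dualMap)

/-- The sequence `0 → B₀^* → B₁^* → H ⊕ H^* → B₁ → B₀` with the maps `δ₄ = δ₁^*`, `δ₃ = δ₂^*`,
`δ₂`, `δ₁` is a resolution (of the cokernel of `δ₁`). -/
structure IsSelfDualResolution (δ₁ : B₁ →ₗ[R] B₀) (δ₂ : Hyp R H →ₗ[R] B₁) : Prop where
  injective : Function.Injective (delta4 δ₁)
  exact₃ : Function.Exact (delta4 δ₁) (delta3 δ₂)
  exact₂ : Function.Exact (delta3 δ₂) δ₂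
  exact₁ : Function.Exact δ₂ δ₁

/-- Over the fraction field `K`, the isotropic subspaces `im δ₃` and `H^*` of `H ⊕ H^*` lie in
different components; here `n = rank H`. -/
def DualInOtherComponent (n : ℕ) (δ₂ : Hyp R H →ₗ[R] B₁) [IsDomain R] : Prop :=
  OppositeComponents n
    (LinearMap.range ((delta3 δ₂).baseChange (FractionRing R)))
    (LinearMap.range ((LinearMap.inl R (Module.Dual R H) H).baseChange (FractionRing R)))

/-- `a₃ ∈ ⋀ⁿ (H ⊕ H^*)` is the third Buchsbaum–Eisenbud multiplier of the resolution, for some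
choice of bases of `B₀^*` and `B₁^*` (two choices change `a₃` by a unit only).  With
`a₄ = δ₄ b₁ ∧ ⋯ ∧ δ₄ bᵣ` for a basis `b` of `B₀^*`, the map `⋀ⁿ δ₃` is the composite of
`ξ ↦ ξ ∧ a₄ ∈ ⋀ⁿ⁺ʳ B₁^* ≅ R` and of `1 ↦ a₃`. -/
def IsMultiplier (n r : ℕ) (δ₁ : B₁ →ₗ[R] B₀) (δ₂ : Hyp R H →ₗ[R] B₁)
    (a₃ : ⋀[R]^n (Hyp R H)) : Prop :=
  ∃ (b : Module.Basis (Fin r) R (Module.Dual R B₀))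
    (c : Module.Basis (Fin n ⊕ Fin r) R (Module.Dual R B₁)),
    ∀ v : Fin n → Module.Dual R B₁,
      exteriorPower.ιMulti R n (fun i => delta3 δ₂ (v i)) =
        c.det (Sum.elim v fun j => delta4 δ₁ (b j)) • a₃

/-- `a ∈ ⋀^odd H` gives spinor coordinates of the resolution: up to a unit, the map
`S₂(⋀^odd H) → ⋀ⁿ (H ⊕ H^*)` sends `a²` to the Buchsbaum–Eisenbud multiplier `a₃`. -/
def IsSpinorCoordinates [Invertible (2 : R)] (n r : ℕ) (δ₁ : B₁ →ₗ[R] B₀)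
    (δ₂ : Hyp R H →ₗ[R] B₁) (a : VOdd R H) : Prop :=
  ∃ (e : Module.Basis (Fin n) R H) (a₃ : ⋀[R]^n (Hyp R H)) (ε : Rˣ),
    IsMultiplier n r δ₁ δ₂ a₃ ∧
    spinorP e (a : ExteriorAlgebra R H) a = (ε : R) • wedgePairing R H n a₃

/-- `w : (⋀^even H)^* → B₁^*` lifts along `δ₃` the dual `(⋀^even H)^* → (H ⊕ H^*)^* ≅ H ⊕ H^*` of
`x ↦ x · a`. -/
def IsSpinorLift (δ₂ : Hyp R H →ₗ[R] B₁) (a : VOdd R H)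
    (w : Module.Dual R (VEven R H) →ₗ[R] Module.Dual R B₁) : Prop :=
  LinearMap.comp (LinearMap.dualProd R H) ((delta3 δ₂).comp w) = (actOn a).dualMap

/-- `d₁ : H^* → R`, the restriction of `a^* : (⋀^odd H)^* → R` to `H^*`, where
`H^* ⊆ (⋀^odd H)^*` through the projection of `⋀^odd H` to its component `H`. -/
def d₁ (a : VOdd R H) : Module.Dual R H →ₗ[R] R :=
  (Module.Dual.eval R (VOdd R H) a).comp
    ((ExteriorAlgebra.ιInv (R := R) (M := H)).comp (VOdd R H).subtype).dualMap

/-- `d₂ : B₁^* → H^*`, the dual of the restriction of `δ₂` to `H`. -/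
def d₂ (δ₂ : Hyp R H →ₗ[R] B₁) : Module.Dual R B₁ →ₗ[R] Module.Dual R H :=
  (δ₂.comp (LinearMap.inr R (Module.Dual R H) H)).dualMap

/-- The generator of `R = ⋀⁰ H^* ⊆ (⋀^even H)^*`, i.e. the projection of `⋀^even H` to `⋀⁰ H = R`. -/
def scalarFunctional (R H : Type*) [CommRing R] [AddCommGroup H] [Module R H] :
    Module.Dual R (VEven R H) :=
  (ExteriorAlgebra.algebraMapInv (R := R) (M := H)).toLinearMap.comp (VEven R H).subtype

/-- `d₃ = [δ₄, w|_R] : B₀^* ⊕ R → B₁^*`. -/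
def d₃ (δ₁ : B₁ →ₗ[R] B₀) (w : Module.Dual R (VEven R H) →ₗ[R] Module.Dual R B₁) :
    Module.Dual R B₀ × R →ₗ[R] Module.Dual R B₁ :=
  (delta4 δ₁).coprod (w.comp (LinearMap.toSpanSingleton R _ (scalarFunctional R H)))

/-- The ideal `I` generated by the entries of `d₁`, i.e. the image of `d₁ : H^* → R`. -/
def idealI (a : VOdd R H) : Ideal R := LinearMap.range (d₁ a)

end Resolution

end SpinorRes

end

/-!
Over the fraction field, `im δ₃` is a maximal isotropic subspace, so it is annihilated by a spinor
that is unique up to a scalar, and this spinor is odd by the parity assumption.  Over the unique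
factorization domain `R` it has a primitive representative `s`, and `P(s²)` is proportional to `a₃`.
For every prime `π` there are `n` elements of `im δ₃` that are in duality, up to a factor prime to
`π`, with `n` vectors spanning an isotropic submodule, and neither `P(s²)` nor `a₃` is divisible by
`π` at these vectors.  So both are primitive, and they differ by a unit.

Conversely, evaluating `P(a²)` on the isotropic subspaces spanned by half of a frame gives, up to
units of the fraction field, the squares of the coordinates of `a` in the corresponding basis of
pure spinors.  So if `P(a²)` is proportional to `a₃`, all coordinates but one vanish, and
`x · a = 0` for all `x ∈ im δ₃`.  The existence of the lift and the identities of a complex all come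
from this one equation.

If `grade I ≥ 3`, then `Hom(R/I, R/r) = 0` and `Hom(I, R/r) = R/r` for all `r ≠ 0`.  Reading off
the scalar component of `d' ⌋ d ⌋ (x · a) = 0` shows that the form `d ↦ d(m)` given by
`δ₃ φ = (f, m)` is proportional to `d₁`, exactly if `f = 0` and modulo `r` if `r ∣ f`; the two
statements on `Hom` turn this into exactness.  If `grade I > 3`, the vanishing of `Ext^i(R/I, R)`
for `i ≤ 3` splits the resolution of `R/I` from the left, until `I` is a direct summand of `R`.
-/

open scoped TensorProduct

noncomputable section

namespace SpinorRes

local notation "⟪" x "," y "⟫" => LinearMap.dualProd _ _ x y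

section SpinorAlgebra

variable {R H : Type*} [CommRing R] [AddCommGroup H] [Module R H]

/-- The contraction `d ⌋ s`, as an endomorphism of `⋀ H` (and not of the Clifford algebra of the
zero form, to which `⋀ H` unfolds). -/
abbrev contr (d : Module.Dual R H) : Module.End R (ExteriorAlgebra R H) :=
  CliffordAlgebra.contractLeft (Q := (0 : QuadraticForm R H)) d

theorem contr_ι_mul (d : Module.Dual R H) (m : H) (s : ExteriorAlgebra R H) :
    contr d (ExteriorAlgebra.ι R m * s) = d m • s - ExteriorAlgebra.ι R m * contr d s :=
  CliffordAlgebra.contractLeft_ι_mul d m s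

theorem contr_one (d : Module.Dual R H) : contr d 1 = 0 :=
  CliffordAlgebra.contractLeft_one (Q := (0 : QuadraticForm R H)) d

theorem exteriorAlgebra_left_induction {N : Submodule R (ExteriorAlgebra R H)} (one : 1 ∈ N)
    (ι_mul : ∀ m, ∀ s ∈ N, ExteriorAlgebra.ι R m * s ∈ N) (s : ExteriorAlgebra R H) : s ∈ N := by
  refine CliffordAlgebra.left_induction (0 : QuadraticForm R H) (P := (· ∈ N)) (fun r => ?_)
    (fun s t => N.add_mem) (fun s m => ι_mul m s) s
  rw [Algebra.algebraMap_eq_smul_one]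
  exact N.smul_mem r one

theorem dualProd_eq_add (x y : Hyp R H) : ⟪x, y⟫ = x.1 y.2 + y.1 x.2 := by
  rw [LinearMap.dualProd_apply_apply, add_comm]

theorem dualProd_comm (x y : Hyp R H) : ⟪x, y⟫ = ⟪y, x⟫ :=
  (LinearMap.isSymm_dualProd R H).eq x y

theorem dualProd_self (x : Hyp R H) : ⟪x, x⟫ = 2 * QuadraticForm.dualProd R H x := by
  rw [dualProd_eq_add, QuadraticForm.dualProd_apply, two_mul]

theorem polar_dualProd (x y : Hyp R H) :
    QuadraticMap.polar (QuadraticForm.dualProd R H) x y = ⟪x, y⟫ := by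
  simp only [QuadraticMap.polar, QuadraticForm.dualProd_apply, dualProd_eq_add, Prod.fst_add,
    Prod.snd_add, LinearMap.add_apply, map_add]
  ring

theorem spinorAct_spinorAct_self (x : Hyp R H) (s : ExteriorAlgebra R H) :
    spinorAct R H x (spinorAct R H x s) = QuadraticForm.dualProd R H x • s := by
  rw [← Module.End.mul_apply, spinorAct_sq, Module.algebraMap_end_apply]

theorem spinorAct_spinorAct_of_isotropic [Invertible (2 : R)] {x : Hyp R H}
    (hx : ⟪x, x⟫ = 0) (s : ExteriorAlgebra R H) :
    spinorAct R H x (spinorAct R H x s) = 0 := by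
  rw [dualProd_self, (isUnit_of_invertible (2 : R)).mul_right_eq_zero] at hx
  rw [spinorAct_spinorAct_self, hx, zero_smul]

theorem spinorAct_anticomm (x y : Hyp R H) (s : ExteriorAlgebra R H) :
    spinorAct R H x (spinorAct R H y s) + spinorAct R H y (spinorAct R H x s) = ⟪x, y⟫ • s := by
  have hsum := spinorAct_spinorAct_self (x + y) s
  simp only [map_add, LinearMap.add_apply, spinorAct_spinorAct_self] at hsum
  rw [← polar_dualProd, QuadraticMap.polar, sub_smul, sub_smul, ← hsum]
  abel

theorem spinorAct_swap (x y : Hyp R H) (s : ExteriorAlgebra R H) :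
    spinorAct R H x (spinorAct R H y s) = ⟪x, y⟫ • s - spinorAct R H y (spinorAct R H x s) :=
  eq_sub_of_add_eq (spinorAct_anticomm x y s)

theorem spinorAct_inl (d : Module.Dual R H) (s : ExteriorAlgebra R H) :
    spinorAct R H (d, 0) s = contr d s := by
  rw [spinorAct_apply, map_zero, zero_mul, zero_add]

theorem spinorAct_inr (h : H) (s : ExteriorAlgebra R H) :
    spinorAct R H (0, h) s = ExteriorAlgebra.ι R h * s := by
  rw [spinorAct_apply, map_zero, LinearMap.zero_apply, add_zero]

theorem spinorAct_mem_evenOdd (x : Hyp R H) {i : ZMod 2} {s : ExteriorAlgebra R H}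
    (hs : s ∈ CliffordAlgebra.evenOdd (0 : QuadraticForm R H) i) :
    spinorAct R H x s ∈ CliffordAlgebra.evenOdd (0 : QuadraticForm R H) (i + 1) := by
  rw [spinorAct_apply]
  refine Submodule.add_mem _ ?_ (contractLeft_mem x.1 i s hs)
  rw [add_comm]
  exact CliffordAlgebra.evenOdd_mul_le _ 1 i
    (Submodule.mul_mem_mul (CliffordAlgebra.ι_mem_evenOdd_one _ x.2) hs)

end SpinorAlgebra

section SpinorForm

variable {R H : Type*} [CommRing R] [AddCommGroup H] [Module R H] {n : ℕ}
  (e : Module.Basis (Fin n) R H)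

theorem contr_ιMulti_mem_exteriorPower (d : Module.Dual R H) :
    ∀ (k : ℕ) (v : Fin (k + 1) → H), contr d (ExteriorAlgebra.ιMulti R (k + 1) v) ∈ ⋀[R]^k H
  | 0, v => by
    rw [ExteriorAlgebra.ιMulti_succ_apply, ExteriorAlgebra.ιMulti_zero_apply, contr_ι_mul,
      contr_one, mul_zero, sub_zero, ExteriorAlgebra.exteriorPower, pow_zero]
    exact Submodule.smul_mem _ _ (Submodule.one_le.mp le_rfl)
  | k + 1, v => by
    rw [ExteriorAlgebra.ιMulti_succ_apply, contr_ι_mul]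
    refine Submodule.sub_mem _ (Submodule.smul_mem _ _ ?_) ?_
    · exact (exteriorPower.ιMulti R (k + 1) (Matrix.vecTail v)).2
    · rw [ExteriorAlgebra.exteriorPower, pow_succ']
      exact Submodule.mul_mem_mul ⟨v 0, rfl⟩ (contr_ιMulti_mem_exteriorPower d k _)

theorem topCoeff_ιMulti_self (v : Fin n → H) :
    topCoeff e (ExteriorAlgebra.ιMulti R n v) = e.det v := by
  rw [topCoeff, ExteriorAlgebra.liftAlternating_apply_ιMulti, Pi.single_eq_same]

theorem topCoeff_of_mem_exteriorPower {k : ℕ} (hk : k ≠ n) {s : ExteriorAlgebra R H}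
    (hs : s ∈ ⋀[R]^k H) : topCoeff e s = 0 := by
  suffices h : ⋀[R]^k H ≤ LinearMap.ker (topCoeff e) from h hs
  rw [← ExteriorAlgebra.ιMulti_span_fixedDegree, Submodule.span_le]
  rintro _ ⟨v, rfl⟩
  rw [SetLike.mem_coe, LinearMap.mem_ker, topCoeff, ExteriorAlgebra.liftAlternating_apply_ιMulti,
    Pi.single_eq_of_ne hk, AlternatingMap.zero_apply]

theorem topCoeff_contr (d : Module.Dual R H) (s : ExteriorAlgebra R H) :
    topCoeff e (contr d s) = 0 := by
  suffices h : topCoeff e ∘ₗ contr d = 0 from LinearMap.congr_fun h s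
  have hιMulti : ∀ k ≤ n, ∀ v : Fin k → H,
      topCoeff e (contr d (ExteriorAlgebra.ιMulti R k v)) = 0 := by
    rintro (_ | k) hk v
    · rw [ExteriorAlgebra.ιMulti_zero_apply, contr_one, map_zero]
    · exact topCoeff_of_mem_exteriorPower e (by omega) (contr_ιMulti_mem_exteriorPower d k v)
  refine Module.Basis.ext e.ExteriorAlgebra fun S => ?_
  rw [LinearMap.comp_apply, LinearMap.zero_apply, ExteriorAlgebra.basis_apply]
  exact hιMulti _ (by simpa using S.card_le_univ) _

/-- Contraction is an antiderivation that kills the top coefficient, hence this integration by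
parts. -/
theorem topCoeff_contractRight_mul (d : Module.Dual R H) (u t : ExteriorAlgebra R H) :
    topCoeff e (CliffordAlgebra.contractRight (Q := (0 : QuadraticForm R H)) u d * t) =
      topCoeff e (u * contr d t) := by
  induction u using CliffordAlgebra.right_induction generalizing t with
  | algebraMap r =>
    rw [CliffordAlgebra.contractRight_algebraMap, zero_mul, map_zero, ← Algebra.smul_def, map_smul,
      topCoeff_contr, smul_zero]
  | add u v hu hv => simp only [map_add, LinearMap.add_apply, add_mul, hu, hv]
  | mul_ι m u hu =>
    have hmt := hu (ExteriorAlgebra.ι R m * t)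
    rw [contr_ι_mul, mul_sub, map_sub, mul_smul_comm, map_smul] at hmt
    rw [CliffordAlgebra.contractRight_mul_ι, sub_mul, map_sub, smul_mul_assoc, map_smul, mul_assoc,
      mul_assoc, hmt]
    abel

theorem spinorForm_apply (s t : ExteriorAlgebra R H) :
    spinorForm e s t = topCoeff e (CliffordAlgebra.reverse (Q := (0 : QuadraticForm R H)) s * t) :=
  rfl

theorem spinorForm_spinorAct (x : Hyp R H) (s t : ExteriorAlgebra R H) :
    spinorForm e (spinorAct R H x s) t = spinorForm e s (spinorAct R H x t) := by
  have reverse_ι_mul : CliffordAlgebra.reverse (Q := (0 : QuadraticForm R H))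
      (ExteriorAlgebra.ι R x.2 * s) = CliffordAlgebra.reverse s * ExteriorAlgebra.ι R x.2 := by
    rw [CliffordAlgebra.reverse.map_mul]
    exact congrArg _ (CliffordAlgebra.reverse_ι x.2)
  rw [spinorForm_apply, spinorForm_apply, spinorAct_apply, spinorAct_apply, map_add, add_mul,
    map_add, mul_add, map_add, reverse_ι_mul, mul_assoc, ← topCoeff_contractRight_mul,
    CliffordAlgebra.contractRight_eq, CliffordAlgebra.reverse_reverse]

end SpinorForm

section ActProd

variable {R H : Type*} [CommRing R] [AddCommGroup H] [Module R H]

/-- The action on `⋀ H` of the Clifford product of a list of vectors of `H ⊕ H^*`. -/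
def actProd (L : List (Hyp R H)) : Module.End R (ExteriorAlgebra R H) :=
  (L.map (spinorAct R H)).prod

theorem actProd_nil (s : ExteriorAlgebra R H) : actProd [] s = s := rfl

theorem actProd_cons (x : Hyp R H) (L : List (Hyp R H)) (s : ExteriorAlgebra R H) :
    actProd (x :: L) s = spinorAct R H x (actProd L s) := by
  rw [actProd, actProd, List.map_cons, List.prod_cons, Module.End.mul_apply]

theorem actProd_append (L L' : List (Hyp R H)) (s : ExteriorAlgebra R H) :
    actProd (L ++ L') s = actProd L (actProd L' s) := by
  rw [actProd, actProd, actProd, List.map_append, List.prod_append, Module.End.mul_apply]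

theorem actProd_inr {ι : Type*} (u : ι → H) (L : List ι) (s : ExteriorAlgebra R H) :
    actProd (L.map fun i => ((0, u i) : Hyp R H)) s =
      (L.map fun i => ExteriorAlgebra.ι R (u i)).prod * s := by
  induction L with
  | nil => rw [List.map_nil, List.map_nil, actProd_nil, List.prod_nil, one_mul]
  | cons i L ih =>
    rw [List.map_cons, actProd_cons, ih, spinorAct_inr, List.map_cons, List.prod_cons, mul_assoc]

theorem spinorAct_actProd_of_orthogonal {x : Hyp R H} {L : List (Hyp R H)}
    (hL : ∀ z ∈ L, ⟪x, z⟫ = 0) (s : ExteriorAlgebra R H) :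
    spinorAct R H x (actProd L s) = (-1 : R) ^ L.length • actProd L (spinorAct R H x s) := by
  induction L with
  | nil => rw [List.length_nil, pow_zero, one_smul, actProd_nil, actProd_nil]
  | cons z L ih =>
    rw [List.forall_mem_cons] at hL
    rw [actProd_cons, spinorAct_swap, hL.1, zero_smul, zero_sub, ih hL.2, actProd_cons, map_smul,
      List.length_cons, pow_succ, mul_neg_one, neg_smul]

theorem spinorAct_actProd_eq_zero {x : Hyp R H} {s : ExteriorAlgebra R H}
    (hs : spinorAct R H x s = 0) {L : List (Hyp R H)} (hL : ∀ z ∈ L, ⟪x, z⟫ = 0) :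
    spinorAct R H x (actProd L s) = 0 := by
  rw [spinorAct_actProd_of_orthogonal hL, hs, map_zero, smul_zero]

theorem actProd_reverse {L : List (Hyp R H)} (hL : L.Pairwise fun x z => ⟪x, z⟫ = 0)
    (s : ExteriorAlgebra R H) :
    actProd L.reverse s = (-1 : R) ^ L.length.choose 2 • actProd L s := by
  induction L generalizing s with
  | nil => rw [List.length_nil, Nat.choose_zero_succ, pow_zero, one_smul, List.reverse_nil]
  | cons x L ih =>
    obtain ⟨hx, hL⟩ := List.pairwise_cons.mp hL
    have hmove : actProd L (spinorAct R H x s) =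
        (-1 : R) ^ L.length • spinorAct R H x (actProd L s) := by
      rw [spinorAct_actProd_of_orthogonal hx, smul_smul, ← mul_pow, neg_one_mul, neg_neg, one_pow,
        one_smul]
    rw [List.reverse_cons, actProd_append, ih hL, actProd_cons, actProd_nil, hmove, smul_smul,
      ← pow_add, List.length_cons, actProd_cons, Nat.choose_succ_succ' L.length 1,
      Nat.choose_one_right, add_comm]

theorem spinorAct_actProd_eq_zero_of_mem [Invertible (2 : R)] {x : Hyp R H}
    {L : List (Hyp R H)} (hx : x ∈ L) (hL : ∀ z ∈ L, ⟪x, z⟫ = 0) (s : ExteriorAlgebra R H) :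
    spinorAct R H x (actProd L s) = 0 := by
  induction L with
  | nil => exact absurd hx List.not_mem_nil
  | cons z L ih =>
    rw [List.forall_mem_cons] at hL
    rw [actProd_cons]
    rcases List.mem_cons.mp hx with rfl | hx
    · exact spinorAct_spinorAct_of_isotropic hL.1 _
    · rw [spinorAct_swap, hL.1, zero_smul, ih hx hL.2, map_zero, sub_zero]

theorem spinorForm_actProd {n : ℕ} (e : Module.Basis (Fin n) R H) (L : List (Hyp R H))
    (s t : ExteriorAlgebra R H) :
    spinorForm e (actProd L s) t = spinorForm e s (actProd L.reverse t) := by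
  induction L generalizing t with
  | nil => rfl
  | cons x L ih =>
    rw [actProd_cons, spinorForm_spinorAct, ih, List.reverse_cons, actProd_append, actProd_cons,
      actProd_nil]

theorem actProd_mem_evenOdd (L : List (Hyp R H)) {i : ZMod 2} {s : ExteriorAlgebra R H}
    (hs : s ∈ CliffordAlgebra.evenOdd (0 : QuadraticForm R H) i) :
    actProd L s ∈ CliffordAlgebra.evenOdd (0 : QuadraticForm R H) (i + L.length) := by
  induction L with
  | nil => simpa only [List.length_nil, Nat.cast_zero, add_zero, actProd_nil] using hs
  | cons x L ih =>
    rw [List.length_cons, Nat.cast_succ, ← add_assoc]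
    exact spinorAct_mem_evenOdd x ih

end ActProd

section Frames

variable {R H ι : Type*} [CommRing R] [AddCommGroup H] [Module R H] [DecidableEq ι]

/-- Two families of vectors that span isotropic submodules in duality up to the factor `y`: a
hyperbolic basis of `H ⊕ H^*` when there are `rank H` vectors in each family and `y` is a unit. -/
structure IsFrame (l v : ι → Hyp R H) (y : R) : Prop where
  left (i j : ι) : ⟪l i, l j⟫ = 0
  right (i j : ι) : ⟪v i, v j⟫ = 0
  pair (i j : ι) : ⟪l i, v j⟫ = if i = j then y else 0

theorem isFrame_basis (e : Module.Basis ι R H) :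
    IsFrame (fun i => ((e.coord i, 0) : Hyp R H)) (fun i => (0, e i)) 1 where
  left i j := by simp only [dualProd_eq_add, map_zero, add_zero]
  right i j := by simp only [dualProd_eq_add, LinearMap.zero_apply, add_zero]
  pair i j := by
    simp only [dualProd_eq_add, LinearMap.zero_apply, add_zero, Module.Basis.coord_apply,
      Module.Basis.repr_self, Finsupp.single_apply, eq_comm]

namespace IsFrame

variable {l v : ι → Hyp R H} {y : R} (hf : IsFrame l v y)

include hf

theorem pair' (i j : ι) : ⟪v i, l j⟫ = if i = j then y else 0 := by
  rw [dualProd_comm, hf.pair]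
  simp only [eq_comm]

theorem piecewise (J : Finset ι) : IsFrame (J.piecewise l v) (J.piecewise v l) y where
  left i j := by
    by_cases hi : i ∈ J <;> by_cases hj : j ∈ J <;>
      simp only [Finset.piecewise, hi, hj, if_true, if_false, hf.left, hf.right, hf.pair, hf.pair',
        ite_eq_right_iff] <;> rintro rfl <;> contradiction
  right i j := by
    by_cases hi : i ∈ J <;> by_cases hj : j ∈ J <;>
      simp only [Finset.piecewise, hi, hj, if_true, if_false, hf.left, hf.right, hf.pair, hf.pair',
        ite_eq_right_iff] <;> rintro rfl <;> contradiction
  pair i j := by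
    by_cases hi : i ∈ J <;> by_cases hj : j ∈ J <;>
      simp only [Finset.piecewise, hi, hj, if_true, if_false, hf.left, hf.right, hf.pair, hf.pair',
        right_eq_ite_iff] <;> rintro rfl <;> contradiction

theorem smul_eq_spinorAct_add (i : ι) (z : ExteriorAlgebra R H) :
    y • z = spinorAct R H (l i) (spinorAct R H (v i) z) +
      spinorAct R H (v i) (spinorAct R H (l i) z) := by
  rw [spinorAct_anticomm, hf.pair, if_pos rfl]

theorem induction [Fintype ι] [Invertible (2 : R)] {C N : Submodule R (ExteriorAlgebra R H)}
    (hCl : ∀ i, ∀ s ∈ C, spinorAct R H (l i) s ∈ C)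
    (hCv : ∀ i, ∀ s ∈ C, spinorAct R H (v i) s ∈ C)
    (hNv : ∀ i, ∀ s ∈ N, spinorAct R H (v i) s ∈ N)
    (hCN : ∀ z ∈ C, (∀ i, spinorAct R H (l i) z = 0) → z ∈ N) {z : ExteriorAlgebra R H}
    (hz : z ∈ C) : y ^ Fintype.card ι • z ∈ N := by
  suffices h : ∀ (T : Finset ι) (z : ExteriorAlgebra R H), z ∈ C →
      (∀ i ∉ T, spinorAct R H (l i) z = 0) → y ^ T.card • z ∈ N from
    h Finset.univ z hz fun i hi => absurd (Finset.mem_univ i) hi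
  intro T
  induction T using Finset.induction_on with
  | empty => exact fun z hz hl => by simpa using hCN z hz fun i => hl i (Finset.notMem_empty i)
  | insert j T hj ih =>
    intro z hz hl
    rw [Finset.card_insert_of_notMem hj, pow_succ, mul_smul, hf.smul_eq_spinorAct_add j, smul_add]
    have hkilled (i) (hi : i ∉ T) : i = j ∨ i ≠ j ∧ spinorAct R H (l i) z = 0 := by
      rcases eq_or_ne i j with rfl | hij
      · exact Or.inl rfl
      · exact Or.inr ⟨hij, hl i (by simp [hij, hi])⟩
    refine N.add_mem (ih _ (hCl j _ (hCv j z hz)) fun i hi => ?_) ?_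
    · rcases hkilled i hi with rfl | ⟨hij, hi⟩
      · exact spinorAct_spinorAct_of_isotropic (hf.left i i) _
      · rw [spinorAct_swap, hf.left, spinorAct_swap (l i), hf.pair, if_neg hij, hi]
        simp only [zero_smul, map_zero, sub_zero]
    · rw [← map_smul]
      refine hNv j _ (ih _ (hCl j z hz) fun i hi => ?_)
      rcases hkilled i hi with rfl | ⟨-, hi⟩
      · exact spinorAct_spinorAct_of_isotropic (hf.left i i) _
      · rw [spinorAct_swap, hf.left, hi, zero_smul, map_zero, sub_zero]

theorem mem_of_actProd_mem {N : Submodule R (ExteriorAlgebra R H)}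
    (hNl : ∀ i, ∀ s ∈ N, spinorAct R H (l i) s ∈ N) (hNy : ∀ s, y • s ∈ N → s ∈ N)
    {z : ExteriorAlgebra R H} (hz : ∀ i, spinorAct R H (l i) z = 0) {L : List ι} (hL : L.Nodup)
    (hmem : actProd (L.map v) z ∈ N) : z ∈ N := by
  induction L with
  | nil => exact hmem
  | cons i L ih =>
    obtain ⟨hi, hL⟩ := List.nodup_cons.mp hL
    have hkilled : spinorAct R H (l i) (actProd (L.map v) z) = 0 := by
      refine spinorAct_actProd_eq_zero (hz i) (List.forall_mem_map.mpr fun j hj => ?_)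
      rw [hf.pair, if_neg (ne_of_mem_of_not_mem hj hi).symm]
    refine ih hL (hNy _ ?_)
    rw [hf.smul_eq_spinorAct_add i, hkilled, map_zero, add_zero, ← actProd_cons]
    exact hNl i _ hmem

end IsFrame

end Frames

section TopElement

variable {R H : Type*} [CommRing R] [AddCommGroup H] [Module R H] {n : ℕ}
  (e : Module.Basis (Fin n) R H)

theorem algebraMapInv_ι_mul (m : H) (s : ExteriorAlgebra R H) :
    ExteriorAlgebra.algebraMapInv (ExteriorAlgebra.ι R m * s) = 0 := by
  rw [map_mul, ExteriorAlgebra.algebraMapInv, ExteriorAlgebra.lift_ι_apply, LinearMap.zero_apply,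
    zero_mul]

theorem ιMulti_basis_mul_ι (m : H) :
    ExteriorAlgebra.ιMulti R n e * ExteriorAlgebra.ι R m = 0 := by
  have mul_ι (m : H) : ExteriorAlgebra.ιMulti R n e * ExteriorAlgebra.ι R m =
      ExteriorAlgebra.ιMulti R (n + 1) (Fin.snoc (α := fun _ => H) e m) := by
    rw [ExteriorAlgebra.ιMulti_apply, ExteriorAlgebra.ιMulti_apply, List.ofFn_succ']
    simp only [Fin.snoc_castSucc, Fin.snoc_last, List.concat_eq_append, List.prod_append,
      List.prod_cons, List.prod_nil, mul_one]
  rw [← e.sum_repr m, map_sum, Finset.mul_sum]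
  refine Finset.sum_eq_zero fun i _ => ?_
  rw [map_smul, mul_smul_comm, mul_ι, AlternatingMap.map_eq_zero_of_eq _ _ (i := i.castSucc)
    (j := Fin.last n) (by rw [Fin.snoc_castSucc, Fin.snoc_last]) (Fin.castSucc_lt_last i).ne,
    smul_zero]

theorem ιMulti_basis_mul (s : ExteriorAlgebra R H) :
    ExteriorAlgebra.ιMulti R n e * s =
      ExteriorAlgebra.algebraMapInv s • ExteriorAlgebra.ιMulti R n e := by
  refine exteriorAlgebra_left_induction (N := LinearMap.eqLocus
    (LinearMap.mulLeft R (ExteriorAlgebra.ιMulti R n e))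
    (ExteriorAlgebra.algebraMapInv.toLinearMap.smulRight (ExteriorAlgebra.ιMulti R n e))) ?_ ?_ s
  · simp
  · intro m s _
    simp only [LinearMap.mem_eqLocus, LinearMap.mulLeft_apply, LinearMap.smulRight_apply,
      AlgHom.toLinearMap_apply, ← mul_assoc, ιMulti_basis_mul_ι, algebraMapInv_ι_mul, zero_mul,
      zero_smul]

theorem eq_algebraMapInv_smul_one_of_contr_eq_zero {w : ExteriorAlgebra R H}
    (hw : ∀ i, contr (e.coord i) w = 0) :
    w = ExteriorAlgebra.algebraMapInv w • (1 : ExteriorAlgebra R H) := by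
  rw [← sub_eq_zero, ← Submodule.mem_bot R]
  refine (isFrame_basis e).mem_of_actProd_mem (fun i s hs => ?_)
    (fun s hs => by rwa [one_smul] at hs) (fun i => ?_) (List.nodup_finRange n) ?_
  · rw [(Submodule.mem_bot R).mp hs, map_zero]
    exact Submodule.zero_mem _
  · rw [spinorAct_inl, map_sub, map_smul, contr_one, hw, smul_zero, sub_zero]
  · rw [actProd_inr, ← List.ofFn_eq_map, ← ExteriorAlgebra.ιMulti_apply, ιMulti_basis_mul]
    simp

theorem exists_eq_smul_of_dvd_spinorForm [Invertible (2 : R)] {π : R} {u : ExteriorAlgebra R H}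
    (hu : ∀ z, π ∣ spinorForm e z u) : ∃ u', u = π • u' := by
  let C : Submodule R (ExteriorAlgebra R H) :=
    ⨅ z, Submodule.comap (spinorForm e z) (Ideal.span {π})
  have mem_C (u) : u ∈ C ↔ ∀ z, π ∣ spinorForm e z u := by
    simp [C, Ideal.mem_span_singleton]
  have spinorAct_mem_C (x) : ∀ s ∈ C, spinorAct R H x s ∈ C := by
    simp only [mem_C, ← spinorForm_spinorAct]
    exact fun s hs z => hs _
  suffices h : u ∈ LinearMap.range (LinearMap.lsmul R (ExteriorAlgebra R H) π) from
    h.imp fun u' h => h.symm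
  rw [← one_smul R u, ← one_pow (Fintype.card (Fin n))]
  refine (isFrame_basis e).induction (fun i => spinorAct_mem_C _) (fun i => spinorAct_mem_C _)
    ?_ ?_ ((mem_C u).mpr hu)
  · rintro i _ ⟨s, rfl⟩
    exact ⟨spinorAct R H _ s, ((spinorAct R H _).map_smul π s).symm⟩
  · intro z hz hkilled
    have hz1 := eq_algebraMapInv_smul_one_of_contr_eq_zero e fun i =>
      (spinorAct_inl _ _).symm.trans (hkilled i)
    have hdvd := (mem_C z).mp hz (CliffordAlgebra.reverse (ExteriorAlgebra.ιMulti R n e))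
    rw [spinorForm_apply, CliffordAlgebra.reverse_reverse, ιMulti_basis_mul, map_smul,
      topCoeff_ιMulti_self, e.det_self, smul_eq_mul, mul_one] at hdvd
    obtain ⟨c, hc⟩ := hdvd
    exact ⟨c • 1, by rw [hz1, hc, mul_smul]; rfl⟩

end TopElement

section Primitive

variable {R M : Type*} [CommRing R] [AddCommGroup M] [Module R M]

variable (R) in
/-- A vector of a module is primitive if no prime of the ring divides it. -/
def IsPrimitive (s : M) : Prop := ∀ π : R, Prime π → ∀ s' : M, s ≠ π • s'

theorem dvd_or_dvd_of_zero_or_prime [IsDomain R] {π : R} (hπ : π = 0 ∨ Prime π) {a b : R}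
    (h : π ∣ a * b) : π ∣ a ∨ π ∣ b := by
  rcases hπ with rfl | hπ
  · simpa only [zero_dvd_iff, mul_eq_zero] using h
  · exact hπ.dvd_or_dvd h

theorem dvd_of_dvd_pow_of_zero_or_prime [IsDomain R] {π : R} (hπ : π = 0 ∨ Prime π) {a : R} {k : ℕ}
    (h : π ∣ a ^ k) : π ∣ a := by
  rcases hπ with rfl | hπ
  · exact zero_dvd_iff.mpr (eq_zero_of_pow_eq_zero (zero_dvd_iff.mp h))
  · exact hπ.dvd_of_dvd_pow h

theorem exists_eq_smul_of_dvd_repr {ι : Type*} [Finite ι] (b : Module.Basis ι R M) {π : R} {z : M}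
    (h : ∀ i, π ∣ b.repr z i) : ∃ z', z = π • z' := by
  cases nonempty_fintype ι
  choose c hc using h
  refine ⟨∑ i, c i • b i, ?_⟩
  rw [Finset.smul_sum, ← b.sum_repr z]
  exact Finset.sum_congr rfl fun i _ => by rw [smul_smul, ← hc]

theorem exists_eq_smul_of_smul_eq_smul [IsDomain R] [Module.Free R M] [Module.Finite R M] {π : R}
    (hπ : π = 0 ∨ Prime π) {c : R} (hc : ¬ π ∣ c) {z z' : M} (h : c • z = π • z') :
    ∃ z'', z = π • z'' := by
  let b := Module.Free.chooseBasis R M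
  refine exists_eq_smul_of_dvd_repr b fun i => ?_
  have hcoord : c * b.repr z i = π * b.repr z' i := by
    simpa only [map_smul, Finsupp.smul_apply, smul_eq_mul] using congrArg (b.repr · i) h
  exact (dvd_or_dvd_of_zero_or_prime hπ ⟨_, hcoord⟩).resolve_left hc

theorem IsPrimitive.not_exists_eq_smul {s : M} (hs : IsPrimitive R s) (hs0 : s ≠ 0) {π : R}
    (hπ : π = 0 ∨ Prime π) : ¬ ∃ s', s = π • s' := by
  rintro ⟨s', hs'⟩
  rcases hπ with rfl | hπ
  · exact hs0 (hs'.trans (zero_smul R s'))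
  · exact hs π hπ s' hs'

theorem IsPrimitive.exists_eq_smul [IsDomain R] [UniqueFactorizationMonoid R] [Module.Free R M]
    [Module.Finite R M] {s : M} (hs : IsPrimitive R s) {r : R} (hr : r ≠ 0) {c : R} {t : M}
    (h : r • t = c • s) : ∃ c' : R, t = c' • s := by
  induction r using UniqueFactorizationMonoid.induction_on_prime generalizing c with
  | h₁ => exact absurd rfl hr
  | h₂ u hu =>
    obtain ⟨u, rfl⟩ := hu
    refine ⟨↑u⁻¹ * c, ?_⟩
    rw [mul_smul, ← h, smul_smul, Units.inv_mul, one_smul]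
  | h₃ a π ha hπ ih =>
    have hdvd : π ∣ c := by
      by_contra hc
      obtain ⟨s', hs'⟩ := exists_eq_smul_of_smul_eq_smul (Or.inr hπ) hc
        (h.symm.trans (mul_smul _ _ _))
      exact hs π hπ s' hs'
    obtain ⟨c', rfl⟩ := hdvd
    rw [mul_smul, mul_smul] at h
    exact ih ha (smul_right_injective M hπ.ne_zero h)

theorem exists_eq_smul_isPrimitive [IsDomain R] [WfDvdMonoid R] [Module.Free R M] {s : M}
    (hs : s ≠ 0) : ∃ (r : R) (s' : M), s = r • s' ∧ IsPrimitive R s' := by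
  let b := Module.Free.chooseBasis R M
  obtain ⟨i, hi⟩ : ∃ i, b.repr s i ≠ 0 := by
    by_contra! h
    exact hs (b.repr.map_eq_zero_iff.mp (Finsupp.ext h))
  obtain ⟨c, ⟨r, s', hrs', hc⟩, hmin⟩ := (wellFounded_dvdNotUnit (α := R)).has_min
    {c : R | ∃ (r : R) (s' : M), s = r • s' ∧ b.repr s' i = c} ⟨_, 1, s, (one_smul R s).symm, rfl⟩
  refine ⟨r, s', hrs', fun π hπ s'' hs'' => hmin (b.repr s'' i) ⟨r * π, s'', ?_, rfl⟩
    ⟨fun hzero => hi ?_, π, hπ.not_isUnit, ?_⟩⟩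
  · rw [hrs', hs'', smul_smul]
  · simp only [hrs', hs'', map_smul, Finsupp.smul_apply, hzero, smul_zero]
  · rw [← hc, hs'', map_smul, Finsupp.smul_apply, smul_eq_mul, mul_comm]

theorem exists_smul_mem_of_finrank_le [IsDomain R] [Module.Finite R M] (N : Submodule R M)
    (h : Module.finrank R M ≤ Module.finrank R N) (x : M) : ∃ r : R, r ≠ 0 ∧ r • x ∈ N := by
  have hquot : Module.finrank R (M ⧸ N) = 0 := by
    have := Submodule.finrank_quotient_add_finrank N
    omega
  obtain ⟨r, hr, hx⟩ := Module.finrank_eq_zero_iff.mp hquot (Submodule.Quotient.mk x)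
  refine ⟨r, hr, ?_⟩
  rwa [← Submodule.Quotient.mk_smul, Submodule.Quotient.mk_eq_zero] at hx

end Primitive

section Fock

variable {R H : Type*} [CommRing R] [AddCommGroup H] [Module R H] {n : ℕ}

theorem dualProd_constr_self (e : Module.Basis (Fin n) R H) {v : Fin n → Hyp R H}
    (hv : ∀ i j, ⟪v i, v j⟫ = 0) (m : H) : ⟪e.constr R v m, e.constr R v m⟫ = 0 := by
  rw [e.constr_apply_fintype (S := R)]
  simp only [map_sum, LinearMap.sum_apply, map_smul, LinearMap.smul_apply, hv, smul_zero,
    Finset.sum_const_zero]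

variable [Invertible (2 : R)]

/-- The action on spinors of the exterior algebra of an isotropic submodule with generators `v`,
which are indexed by a basis `e` so that the exterior algebra is again `⋀ H`. -/
def fock (e : Module.Basis (Fin n) R H) {v : Fin n → Hyp R H}
    (hv : ∀ i j, ⟪v i, v j⟫ = 0) :
    ExteriorAlgebra R H →ₐ[R] Module.End R (ExteriorAlgebra R H) :=
  ExteriorAlgebra.lift R ⟨(spinorAct R H).comp (e.constr R v), fun m =>
    LinearMap.ext fun s => spinorAct_spinorAct_of_isotropic (dualProd_constr_self e hv m) s⟩

variable {l v : Fin n → Hyp R H} {y : R} (e : Module.Basis (Fin n) R H)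

theorem fock_ι_mul (hv : ∀ i j, ⟪v i, v j⟫ = 0) (m : H) (x s : ExteriorAlgebra R H) :
    fock e hv (ExteriorAlgebra.ι R m * x) s = spinorAct R H (e.constr R v m) (fock e hv x s) := by
  rw [map_mul, Module.End.mul_apply, fock, ExteriorAlgebra.lift_ι_apply, LinearMap.comp_apply]

theorem IsFrame.spinorAct_fock (hf : IsFrame l v y) {s : ExteriorAlgebra R H} {i : Fin n}
    (hs : spinorAct R H (l i) s = 0) (x : ExteriorAlgebra R H) :
    spinorAct R H (l i) (fock e hf.right x s) = y • fock e hf.right (contr (e.coord i) x) s := by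
  have dualProd_constr (m : H) : ⟪l i, e.constr R v m⟫ = y * e.coord i m := by
    rw [e.constr_apply_fintype (S := R), map_sum, Finset.sum_eq_single i]
    · rw [map_smul, hf.pair, if_pos rfl, smul_eq_mul, mul_comm]
      rfl
    · intro j _ hj
      rw [map_smul, hf.pair, if_neg hj.symm, smul_zero]
    · exact fun hi => absurd (Finset.mem_univ i) hi
  let evalAt := (fock e hf.right).toLinearMap.flip s
  suffices h : x ∈ LinearMap.eqLocus (spinorAct R H (l i) ∘ₗ evalAt)
      (y • evalAt ∘ₗ contr (e.coord i)) from h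
  refine exteriorAlgebra_left_induction ?_ (fun m x hx => ?_) x
  · change spinorAct R H (l i) (fock e hf.right 1 s) =
      y • fock e hf.right (contr (e.coord i) 1) s
    rw [map_one, Module.End.one_apply, hs, contr_one, map_zero, LinearMap.zero_apply, smul_zero]
  · change spinorAct R H (l i) (fock e hf.right x s) =
      y • fock e hf.right (contr (e.coord i) x) s at hx
    change spinorAct R H (l i) (fock e hf.right (ExteriorAlgebra.ι R m * x) s) =
      y • fock e hf.right (contr (e.coord i) (ExteriorAlgebra.ι R m * x)) s
    rw [fock_ι_mul, spinorAct_swap, hx, dualProd_constr, contr_ι_mul, map_sub, map_smul,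
      map_smul (fock e hf.right), LinearMap.sub_apply, fock_ι_mul, LinearMap.smul_apply, smul_sub,
      smul_smul]

theorem fock_smul_one_apply (hv : ∀ i j, ⟪v i, v j⟫ = 0) (c : R) (s : ExteriorAlgebra R H) :
    fock e hv (c • 1) s = c • s := by
  rw [map_smul, map_one, LinearMap.smul_apply, Module.End.one_apply]

namespace IsFrame

variable [IsDomain R] (hf : IsFrame l v y) (hy : y ≠ 0) {s t : ExteriorAlgebra R H} (hs0 : s ≠ 0)
  (hs : ∀ i, spinorAct R H (l i) s = 0)

include e hf hy hs0 hs

theorem fock_apply_injective : Function.Injective fun x => fock e hf.right x s := by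
  have : Module.Free R (ExteriorAlgebra R H) := Module.Free.of_basis e.ExteriorAlgebra
  let evalAt := (fock e hf.right).toLinearMap.flip s
  change Function.Injective evalAt
  rw [← LinearMap.ker_eq_bot, eq_bot_iff]
  intro x hx
  suffices h : (1 : R) ^ Fintype.card (Fin n) • x ∈ (⊥ : Submodule R (ExteriorAlgebra R H)) by
    rwa [one_pow, one_smul] at h
  refine (isFrame_basis e).induction (C := LinearMap.ker evalAt) ?_ ?_ ?_ ?_ hx
  · intro i z (hz : fock e hf.right z s = 0)
    have h := hf.spinorAct_fock e (hs i) z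
    rw [hz, map_zero, ← spinorAct_inl] at h
    exact (smul_eq_zero.mp h.symm).resolve_left hy
  · intro i z (hz : fock e hf.right z s = 0)
    change fock e hf.right (spinorAct R H (0, e i) z) s = 0
    rw [spinorAct_inr, fock_ι_mul, hz, map_zero]
  · intro i z hz
    rw [Submodule.mem_bot] at hz ⊢
    rw [hz, map_zero]
  · intro z (hz : fock e hf.right z s = 0) hkilled
    have hscalar := eq_algebraMapInv_smul_one_of_contr_eq_zero e fun i =>
      (spinorAct_inl _ _).symm.trans (hkilled i)
    rw [hscalar, fock_smul_one_apply] at hz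
    rw [Submodule.mem_bot, hscalar, (smul_eq_zero.mp hz).resolve_right hs0, zero_smul]

theorem exists_smul_eq_smul (ht : ∀ i, spinorAct R H (l i) t = 0) :
    ∃ r c : R, r ≠ 0 ∧ r • t = c • s := by
  have : Module.Free R (ExteriorAlgebra R H) := Module.Free.of_basis e.ExteriorAlgebra
  have : Module.Finite R (ExteriorAlgebra R H) := Module.Finite.of_basis e.ExteriorAlgebra
  have hinj := hf.fock_apply_injective e hy hs0 hs
  obtain ⟨r, hr, x, hx : fock e hf.right x s = r • t⟩ := exists_smul_mem_of_finrank_le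
    (LinearMap.range ((fock e hf.right).toLinearMap.flip s))
    (LinearMap.finrank_range_of_inj hinj).ge t
  have hscalar := eq_algebraMapInv_smul_one_of_contr_eq_zero e (w := x) fun i => by
    have h := hf.spinorAct_fock e (hs i) x
    rw [hx, map_smul, ht, smul_zero] at h
    refine hinj ?_
    simp only [(smul_eq_zero.mp h.symm).resolve_left hy, map_zero, LinearMap.zero_apply]
  refine ⟨r, ExteriorAlgebra.algebraMapInv x, hr, ?_⟩
  rw [← hx, ← fock_smul_one_apply e hf.right, ← hscalar]

theorem exists_eq_smul_of_isPrimitive [UniqueFactorizationMonoid R]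
    (hp : IsPrimitive R s) (ht : ∀ i, spinorAct R H (l i) t = 0) : ∃ c : R, t = c • s := by
  have : Module.Free R (ExteriorAlgebra R H) := Module.Free.of_basis e.ExteriorAlgebra
  have : Module.Finite R (ExteriorAlgebra R H) := Module.Finite.of_basis e.ExteriorAlgebra
  obtain ⟨r, c, hr, h⟩ := hf.exists_smul_eq_smul e hy hs0 hs ht
  exact hp.exists_eq_smul hr h

end IsFrame

end Fock

section Clifford

variable {R M : Type*} [CommRing R] [AddCommGroup M] [Module R M] {Q : QuadraticForm R M}

theorem contractLeft_prod_map_ι {d : Module.Dual R M} {L : List M} (hL : ∀ z ∈ L, d z = 0) :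
    CliffordAlgebra.contractLeft d (L.map (CliffordAlgebra.ι Q)).prod = 0 := by
  induction L with
  | nil => exact CliffordAlgebra.contractLeft_one Q d
  | cons z L ih =>
    rw [List.forall_mem_cons] at hL
    rw [List.map_cons, List.prod_cons, CliffordAlgebra.contractLeft_ι_mul, hL.1, zero_smul,
      ih hL.2, mul_zero, sub_zero]

theorem ι_mul_sub_involute_mul_ι (m : M) (x : CliffordAlgebra Q) :
    CliffordAlgebra.ι Q m * x - CliffordAlgebra.involute x * CliffordAlgebra.ι Q m =
      CliffordAlgebra.contractLeft (QuadraticMap.polarBilin Q m) x := by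
  induction x using CliffordAlgebra.left_induction with
  | algebraMap r =>
    rw [AlgHom.commutes, Algebra.commutes, sub_self, CliffordAlgebra.contractLeft_algebraMap]
  | add x y hx hy =>
    rw [map_add, map_add, ← hx, ← hy, mul_add, add_mul]
    abel
  | ι_mul x m' hx =>
    rw [CliffordAlgebra.contractLeft_ι_mul, ← hx, map_mul, CliffordAlgebra.involute_ι, ← mul_assoc,
      eq_sub_of_add_eq (CliffordAlgebra.ι_mul_ι_add_swap m m'), sub_mul, mul_sub, neg_mul, neg_mul,
      ← Algebra.smul_def, QuadraticMap.polarBilin_apply_apply]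
    simp only [mul_assoc]
    abel

variable [Invertible (2 : R)]

theorem equivExterior_symm_ι_mul (m : M) (ω : ExteriorAlgebra R M) :
    (CliffordAlgebra.equivExterior Q).symm (ExteriorAlgebra.ι R m * ω) =
      CliffordAlgebra.ι Q m * (CliffordAlgebra.equivExterior Q).symm ω -
        CliffordAlgebra.contractLeft (QuadraticMap.associated (R := R) Q m)
          ((CliffordAlgebra.equivExterior Q).symm ω) := by
  have hassociated : -QuadraticMap.associated (R := R) (-Q) = QuadraticMap.associated Q := by
    rw [map_neg]
    exact neg_neg (QuadraticMap.associated Q)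
  rw [← hassociated]
  exact CliffordAlgebra.changeForm_ι_mul
    (CliffordAlgebra.changeForm.neg_proof CliffordAlgebra.changeForm.associated_neg_proof) m ω

theorem two_smul_equivExterior_symm_ι_mul (m : M) (ω : ExteriorAlgebra R M) :
    (2 : R) • (CliffordAlgebra.equivExterior Q).symm (ExteriorAlgebra.ι R m * ω) =
      CliffordAlgebra.ι Q m * (CliffordAlgebra.equivExterior Q).symm ω +
        CliffordAlgebra.involute ((CliffordAlgebra.equivExterior Q).symm ω) *
          CliffordAlgebra.ι Q m := by
  have hpolar : (2 : R) • QuadraticMap.associated (R := R) Q m = QuadraticMap.polarBilin Q m := by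
    rw [two_smul, ← QuadraticMap.two_nsmul_associated R Q, two_smul, LinearMap.add_apply]
  rw [equivExterior_symm_ι_mul, smul_sub, ← LinearMap.smul_apply, ← map_smul, hpolar,
    ← ι_mul_sub_involute_mul_ι, two_smul]
  abel

theorem equivExterior_symm_prod_map_ι {L : List M}
    (hL : L.Pairwise fun x z => QuadraticMap.polar Q x z = 0) :
    (CliffordAlgebra.equivExterior Q).symm (L.map (ExteriorAlgebra.ι R)).prod =
      (L.map (CliffordAlgebra.ι Q)).prod := by
  induction L with
  | nil =>
    exact CliffordAlgebra.changeForm_one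
      (CliffordAlgebra.changeForm.neg_proof CliffordAlgebra.changeForm.associated_neg_proof)
  | cons m L ih =>
    rw [List.pairwise_cons] at hL
    rw [List.map_cons, List.prod_cons, equivExterior_symm_ι_mul, ih hL.2,
      contractLeft_prod_map_ι fun z hz => ?_, sub_zero, List.map_cons, List.prod_cons]
    rw [QuadraticMap.associated_apply, ← QuadraticMap.polar, hL.1 z hz, smul_zero]

end Clifford

section SpinorP

variable {R H : Type*} [CommRing R] [AddCommGroup H] [Module R H] {n : ℕ}

theorem cliffordAct_ι (x : Hyp R H) :
    cliffordAct R H (CliffordAlgebra.ι (QuadraticForm.dualProd R H) x) = spinorAct R H x := by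
  rw [cliffordAct, CliffordAlgebra.lift_ι_apply]

theorem cliffordAct_prod_map_ι (L : List (Hyp R H)) :
    cliffordAct R H (L.map (CliffordAlgebra.ι (QuadraticForm.dualProd R H))).prod = actProd L := by
  rw [map_list_prod, List.map_map, actProd]
  exact congrArg List.prod (List.map_congr_left fun x _ => cliffordAct_ι x)

variable [Invertible (2 : R)] (e : Module.Basis (Fin n) R H)

theorem spinorP_ιMulti (s t : ExteriorAlgebra R H) (u : Fin n → Hyp R H) :
    spinorP e s t (exteriorPower.ιMulti R n u) = spinorForm e s (cliffordAct R H
      ((CliffordAlgebra.equivExterior (QuadraticForm.dualProd R H)).symm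
        (ExteriorAlgebra.ιMulti R n u)) t) :=
  rfl

theorem spinorP_ιMulti_of_orthogonal (s t : ExteriorAlgebra R H) {u : Fin n → Hyp R H}
    (hu : ∀ i j, ⟪u i, u j⟫ = 0) :
    spinorP e s t (exteriorPower.ιMulti R n u) = spinorForm e s (actProd (List.ofFn u) t) := by
  have hpairwise : (List.ofFn u).Pairwise
      fun x z => QuadraticMap.polar (QuadraticForm.dualProd R H) x z = 0 := by
    rw [List.pairwise_ofFn]
    exact fun i j _ => (polar_dualProd _ _).trans (hu i j)
  have hprod : ExteriorAlgebra.ιMulti R n u = ((List.ofFn u).map (ExteriorAlgebra.ι R)).prod := by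
    rw [ExteriorAlgebra.ιMulti_apply, List.map_ofFn]
    rfl
  rw [spinorP_ιMulti, hprod, equivExterior_symm_prod_map_ι hpairwise, cliffordAct_prod_map_ι]

theorem spinorP_eq_zero_of_spinorAct_eq_zero {s : ExteriorAlgebra R H} {u : Fin n → Hyp R H}
    (i : Fin n) (hi : spinorAct R H (u i) s = 0) :
    spinorP e s s (exteriorPower.ιMulti R n u) = 0 := by
  have spinorForm_ι_mul {x : Hyp R H} (hx : spinorAct R H x s = 0)
      (ω : ExteriorAlgebra R (Hyp R H)) : spinorForm e s (cliffordAct R H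
        ((CliffordAlgebra.equivExterior _).symm (ExteriorAlgebra.ι R x * ω)) s) = 0 := by
    have h := congrArg (fun c => spinorForm e s (cliffordAct R H c s))
      (two_smul_equivExterior_symm_ι_mul (Q := QuadraticForm.dualProd R H) x ω)
    simp only [map_smul, map_add, map_mul, LinearMap.smul_apply, LinearMap.add_apply,
      Module.End.mul_apply, cliffordAct_ι, hx, map_zero, add_zero] at h
    rw [← spinorForm_spinorAct, hx, map_zero, LinearMap.zero_apply, smul_eq_mul] at h
    exact (isUnit_of_invertible (2 : R)).mul_right_eq_zero.mp h
  cases n with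
  | zero => exact i.elim0
  | succ n =>
    have spinorP_head {u : Fin (n + 1) → Hyp R H} (hu : spinorAct R H (u 0) s = 0) :
        spinorP e s s (exteriorPower.ιMulti R (n + 1) u) = 0 := by
      rw [spinorP_ιMulti, ExteriorAlgebra.ιMulti_succ_apply]
      exact spinorForm_ι_mul hu _
    rcases eq_or_ne i 0 with rfl | hi0
    · exact spinorP_head hi
    · have hswap := spinorP_head (u := u ∘ Equiv.swap i 0) (by simpa using hi)
      rwa [AlternatingMap.map_swap _ _ hi0, map_neg, neg_eq_zero] at hswap

end SpinorP

section Purity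

variable {R H : Type*} [CommRing R] [AddCommGroup H] [Module R H]

namespace IsFrame

theorem eq_zero_of_actProd_piecewise_eq_zero {ι : Type*} [DecidableEq ι] {l v : ι → Hyp R H}
    {y : R} (hf : IsFrame l v y) (hy : IsSMulRegular (ExteriorAlgebra R H) y) {i : ι} {L : List ι}
    (hL : L.Nodup) (hi : i ∉ L) {z : ExteriorAlgebra R H}
    (h : ∀ J : Finset ι, i ∈ J → actProd (L.map (J.piecewise l v)) z = 0) : z = 0 := by
  induction L with
  | nil => exact h {i} (Finset.mem_singleton_self i)
  | cons j L ih =>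
    obtain ⟨hj, hL⟩ := List.nodup_cons.mp hL
    obtain ⟨hij, hi⟩ := not_or.mp (List.mem_cons.not.mp hi)
    have map_congr {J J' : Finset ι} (hJ : ∀ k ≠ j, k ∈ J ↔ k ∈ J') :
        L.map (J.piecewise l v) = L.map (J'.piecewise l v) :=
      List.map_congr_left fun k hk => by
        simp only [Finset.piecewise, hJ k (ne_of_mem_of_not_mem hk hj)]
    refine ih hL hi fun J hJ => hy ?_
    have hinsert := h (insert j J) (Finset.mem_insert_of_mem hJ)
    have herase := h (J.erase j) (Finset.mem_erase.mpr ⟨hij, hJ⟩)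
    rw [List.map_cons, actProd_cons, Finset.piecewise_insert_self,
      map_congr (J' := J) fun k hk => by simp [hk]] at hinsert
    rw [List.map_cons, actProd_cons, Finset.piecewise_eq_of_notMem _ _ _ (Finset.notMem_erase j J),
      map_congr (J' := J) fun k hk => by simp [hk]] at herase
    change y • _ = y • _
    rw [hf.smul_eq_spinorAct_add j, herase, hinsert, map_zero, map_zero, add_zero, smul_zero]

variable [IsDomain R] [Invertible (2 : R)] {n : ℕ} {l v : Fin n → Hyp R H} {y : R}
  (hf : IsFrame l v y) (hy : y ≠ 0) (e : Module.Basis (Fin n) R H) {a : ExteriorAlgebra R H}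

include hf hy e

theorem actProd_eq_zero_of_spinorForm_eq_zero (h : spinorForm e a (actProd (List.ofFn l) a) = 0) :
    actProd (List.ofFn l) a = 0 := by
  have : Module.Free R (ExteriorAlgebra R H) := Module.Free.of_basis e.ExteriorAlgebra
  by_contra ha
  have hpairwise : (List.ofFn l).Pairwise fun x z => ⟪x, z⟫ = 0 :=
    List.pairwise_ofFn.mpr fun i j _ => hf.left i j
  have hkilled {L : List (Hyp R H)} (hL : ∀ x, x ∈ L ↔ x ∈ List.ofFn l) (z) (i : Fin n) :
      spinorAct R H (l i) (actProd L z) = 0 := by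
    refine spinorAct_actProd_eq_zero_of_mem ((hL _).mpr (List.mem_ofFn.mpr ⟨i, rfl⟩))
      (fun x hx => ?_) z
    obtain ⟨j, rfl⟩ := List.mem_ofFn.mp ((hL x).mp hx)
    exact hf.left i j
  have hself : spinorForm e (actProd (List.ofFn l) a) a = 0 := by
    rw [spinorForm_actProd, actProd_reverse hpairwise, map_smul, h, smul_zero]
  suffices h : ∀ z, (0 : R) ∣ spinorForm e z (actProd (List.ofFn l) a) by
    obtain ⟨u, hu⟩ := exists_eq_smul_of_dvd_spinorForm e h
    exact ha (hu.trans (zero_smul R u))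
  intro z
  obtain ⟨r, c, hr, hrc⟩ := hf.exists_smul_eq_smul e hy ha (hkilled (fun _ => Iff.rfl) a)
    (hkilled (fun _ => List.mem_reverse) z)
  have hz := congrArg (spinorForm e · a) hrc
  simp only [map_smul, LinearMap.smul_apply, hself, smul_zero] at hz
  rw [zero_dvd_iff, ← (smul_eq_zero.mp hz).resolve_left hr, spinorForm_actProd,
    List.reverse_reverse]

theorem spinorAct_eq_zero_of_spinorP_piecewise_eq_zero (i : Fin n)
    (h : ∀ J : Finset (Fin n), i ∈ J →
      spinorP e a a (exteriorPower.ιMulti R n (J.piecewise l v)) = 0) :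
    spinorAct R H (l i) a = 0 := by
  have : Module.Free R (ExteriorAlgebra R H) := Module.Free.of_basis e.ExteriorAlgebra
  obtain ⟨A, B, hAB⟩ := List.append_of_mem (List.mem_finRange i)
  have hnodup := hAB ▸ List.nodup_finRange n
  obtain ⟨hi, hnodup⟩ := List.nodup_cons.mp (List.nodup_middle.mp hnodup)
  refine hf.eq_zero_of_actProd_piecewise_eq_zero (.of_ne_zero hy) hnodup hi fun J hJ => ?_
  have hJf := hf.piecewise J
  have hvanish := h J hJ
  rw [spinorP_ιMulti_of_orthogonal _ _ _ hJf.left] at hvanish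
  replace hvanish := hJf.actProd_eq_zero_of_spinorForm_eq_zero hy e hvanish
  have horth : ∀ z ∈ B.map (J.piecewise l v), ⟪l i, z⟫ = 0 := List.forall_mem_map.mpr fun j _ => by
    simpa only [J.piecewise_eq_of_mem l v hJ] using hJf.left i j
  rw [List.ofFn_eq_map, hAB, List.map_append, actProd_append, List.map_cons, actProd_cons,
    J.piecewise_eq_of_mem l v hJ, spinorAct_actProd_of_orthogonal horth, map_smul, ← actProd_append,
    ← List.map_append] at hvanish
  exact (smul_eq_zero.mp hvanish).resolve_left (pow_ne_zero _ (neg_ne_zero.mpr one_ne_zero))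

end IsFrame

end Purity

section Frames

variable {R H : Type*} [CommRing R] [IsDomain R] [AddCommGroup H] [Module R H]

namespace IsFrame

theorem not_dvd_spinorForm_actProd [UniqueFactorizationMonoid R] [Invertible (2 : R)] {n : ℕ}
    {l v : Fin n → Hyp R H} {y : R} (hf : IsFrame l v y) (e : Module.Basis (Fin n) R H) {π : R}
    (hπ : π = 0 ∨ Prime π) (hy : ¬ π ∣ y) {s : ExteriorAlgebra R H} (hs0 : s ≠ 0)
    (hp : IsPrimitive R s) (hs : ∀ i, spinorAct R H (l i) s = 0) :
    ¬ π ∣ spinorForm e s (actProd (List.ofFn v) s) := by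
  intro hdvd
  have : Module.Free R (ExteriorAlgebra R H) := Module.Free.of_basis e.ExteriorAlgebra
  have : Module.Finite R (ExteriorAlgebra R H) := Module.Finite.of_basis e.ExteriorAlgebra
  have hy0 : y ≠ 0 := by
    rintro rfl
    exact hy (dvd_zero π)
  let N : Submodule R (ExteriorAlgebra R H) :=
    Submodule.comap ((spinorForm e).flip (actProd (List.ofFn v) s)) (Ideal.span {π})
  have mem_N (z) : z ∈ N ↔ π ∣ spinorForm e z (actProd (List.ofFn v) s) :=
    Ideal.mem_span_singleton
  have hall (z) : π ∣ spinorForm e z (actProd (List.ofFn v) s) := by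
    have hz : y ^ Fintype.card (Fin n) • z ∈ N := by
      refine hf.induction (C := ⊤) (fun _ _ _ => trivial) (fun _ _ _ => trivial)
        (fun i z _ => ?_) (fun z _ hz => ?_) Submodule.mem_top
      · rw [mem_N, spinorForm_spinorAct, spinorAct_actProd_eq_zero_of_mem
          (List.mem_ofFn.mpr ⟨i, rfl⟩) (List.forall_mem_ofFn_iff.mpr (hf.right i)), map_zero]
        exact dvd_zero π
      · obtain ⟨c, rfl⟩ := hf.exists_eq_smul_of_isPrimitive e hy0 hs0 hs hp hz
        exact N.smul_mem c ((mem_N s).mpr hdvd)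
    rw [mem_N, map_smul, LinearMap.smul_apply, smul_eq_mul] at hz
    exact (dvd_or_dvd_of_zero_or_prime hπ hz).resolve_left fun h =>
      hy (dvd_of_dvd_pow_of_zero_or_prime hπ h)
  obtain ⟨u, hu⟩ := exists_eq_smul_of_dvd_spinorForm e hall
  suffices h : s ∈ LinearMap.range (LinearMap.lsmul R (ExteriorAlgebra R H) π) from
    hp.not_exists_eq_smul hs0 hπ (h.imp fun _ h => h.symm)
  refine hf.mem_of_actProd_mem ?_ (fun z => ?_) hs (List.nodup_finRange n) ?_
  · rintro i _ ⟨z, rfl⟩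
    exact ⟨spinorAct R H (l i) z, ((spinorAct R H (l i)).map_smul π z).symm⟩
  · rintro ⟨z', hz'⟩
    obtain ⟨z'', rfl⟩ := exists_eq_smul_of_smul_eq_smul hπ hy hz'.symm
    exact ⟨z'', rfl⟩
  · rw [← List.ofFn_eq_map]
    exact ⟨u, hu.symm⟩

section Expansion

variable {ι : Type*} [DecidableEq ι] {l v : ι → Hyp R H} {y : R}
  (hf : IsFrame l v y) (hy : y ≠ 0)

include hf hy

theorem linearIndependent [Finite ι] : LinearIndependent R (Sum.elim l v) := by
  cases nonempty_fintype ι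
  rw [Fintype.linearIndependent_iff]
  intro g hg
  rw [Fintype.sum_sum_type] at hg
  simp only [Sum.elim_inl, Sum.elim_inr] at hg
  rintro (i | i)
  · have h := congrArg (LinearMap.dualProd R H (v i)) hg
    simp only [map_add, map_sum, map_smul, map_zero, smul_eq_mul, hf.right, hf.pair', mul_ite,
      mul_zero, Finset.sum_const_zero, Finset.sum_ite_eq, Finset.mem_univ, if_true, add_zero] at h
    exact (mul_eq_zero.mp h).resolve_right hy
  · have h := congrArg (LinearMap.dualProd R H (l i)) hg
    simp only [map_add, map_sum, map_smul, map_zero, smul_eq_mul, hf.left, hf.pair, mul_ite,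
      mul_zero, Finset.sum_const_zero, Finset.sum_ite_eq, Finset.mem_univ, if_true, zero_add] at h
    exact (mul_eq_zero.mp h).resolve_right hy

variable [Module.Free R H] [Module.Finite R H] [Fintype ι]
  (hn : Module.finrank R H = Fintype.card ι)

include hn

theorem smul_eq (x : Hyp R H) :
    y • x = ∑ j, ⟪l j, x⟫ • v j + ∑ j, ⟪v j, x⟫ • l j := by
  let T : Hyp R H →ₗ[R] Hyp R H := ∑ j, (LinearMap.dualProd R H (l j)).smulRight (v j) +
      ∑ j, (LinearMap.dualProd R H (v j)).smulRight (l j)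
  have hT (x) : T x = ∑ j, ⟪l j, x⟫ • v j + ∑ j, ⟪v j, x⟫ • l j := by
    simp [T, LinearMap.sum_apply]
  have hspan : Submodule.span R (Set.range (Sum.elim l v)) ≤
      LinearMap.eqLocus (y • LinearMap.id) T := by
    rw [Submodule.span_le]
    rintro _ ⟨i | i, rfl⟩
    · simp [hT, hf.left, hf.pair']
    · simp [hT, hf.right, hf.pair]
  have hrank : Module.finrank R (Hyp R H) ≤
      Module.finrank R (Submodule.span R (Set.range (Sum.elim l v))) := by
    rw [finrank_span_eq_card (hf.linearIndependent hy), Module.finrank_prod,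
      Module.finrank_linearMap, Module.finrank_self, mul_one, hn, Fintype.card_sum]
  obtain ⟨r, hr, hx⟩ := exists_smul_mem_of_finrank_le _ hrank x
  have hrx : y • r • x = T (r • x) := hspan hx
  rw [map_smul, smul_comm, hT] at hrx
  exact smul_right_injective _ hr hrx

theorem spinorAct_eq_zero {s : ExteriorAlgebra R H} (hs : ∀ i, spinorAct R H (l i) s = 0)
    {x : Hyp R H} (hx : ∀ i, ⟪l i, x⟫ = 0) : spinorAct R H x s = 0 := by
  have := Module.Free.of_basis (Module.finBasis R H).ExteriorAlgebra
  have h := congrArg (spinorAct R H · s) (hf.smul_eq hy hn x)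
  simp only [hx, zero_smul, Finset.sum_const_zero, zero_add, map_smul, map_sum,
    LinearMap.smul_apply, LinearMap.sum_apply, hs, smul_zero] at h
  exact (smul_eq_zero.mp h).resolve_left hy

end Expansion

end IsFrame

end Frames

section ModularRank

variable {R M N P : Type*} [CommRing R] [AddCommGroup M] [Module R M] [AddCommGroup N] [Module R N]
  [AddCommGroup P] [Module R P]

theorem finrank_range_add_finrank_ker_of_isDomain [IsDomain R] [Module.Finite R M]
    (f : M →ₗ[R] N) :
    Module.finrank R (LinearMap.range f) + Module.finrank R (LinearMap.ker f) =
      Module.finrank R M := by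
  rw [← Submodule.finrank_quotient_add_finrank (LinearMap.ker f), f.quotKerEquivRange.finrank_eq]

/-- A family of vectors is linearly independent modulo the element `π` of the ring. For `π = 0`
this is linear independence. -/
def LinIndepMod {ι : Type*} [Fintype ι] (π : R) (x : ι → M) : Prop :=
  ∀ (c : ι → R) (z : M), ∑ i, c i • x i = π • z → ∀ i, π ∣ c i

theorem isPrime_span_of_zero_or_prime [IsDomain R] {π : R} (hπ : π = 0 ∨ Prime π) :
    (Ideal.span {π}).IsPrime := by
  rcases hπ with rfl | hπ
  · rw [Ideal.span_singleton_eq_bot.mpr rfl]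
    exact Ideal.isPrime_bot
  · exact (Ideal.span_singleton_prime hπ.ne_zero).mpr hπ

theorem mk_eq_zero_iff_dvd {π x : R} : Ideal.Quotient.mk (Ideal.span {π}) x = 0 ↔ π ∣ x := by
  rw [Ideal.Quotient.eq_zero_iff_mem, Ideal.mem_span_singleton]

/-- The coordinates of a vector modulo `π`, in a given basis. -/
def redCoord {ι : Type*} (b : Module.Basis ι R M) (π : R) : M →ₗ[R] ι → R ⧸ Ideal.span {π} :=
  LinearMap.pi fun i => (Ideal.Quotient.mkₐ R (Ideal.span {π})).toLinearMap ∘ₗ b.coord i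

theorem redCoord_apply {ι : Type*} (b : Module.Basis ι R M) (π : R) (x : M) (i : ι) :
    redCoord b π x i = Ideal.Quotient.mk _ (b.repr x i) := rfl

theorem redCoord_sum {ι κ : Type*} [Fintype κ] (b : Module.Basis ι R M) (π : R) (c : κ → R)
    (x : κ → M) : redCoord b π (∑ k, c k • x k) =
      ∑ k, Ideal.Quotient.mk (Ideal.span {π}) (c k) • redCoord b π (x k) := by
  simp only [map_sum, map_smul, ← Ideal.Quotient.algebraMap_eq, algebraMap_smul]

theorem redCoord_eq_zero_iff {ι : Type*} [Finite ι] (b : Module.Basis ι R M) {π : R} {x : M} :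
    redCoord b π x = 0 ↔ ∃ z, x = π • z := by
  constructor
  · exact fun h => exists_eq_smul_of_dvd_repr b fun i => mk_eq_zero_iff_dvd.mp (congrFun h i)
  · rintro ⟨z, rfl⟩
    funext i
    rw [redCoord_apply, map_smul, Finsupp.smul_apply, Pi.zero_apply, mk_eq_zero_iff_dvd]
    exact ⟨_, rfl⟩

theorem redCoord_surjective {ι : Type*} [Finite ι] (b : Module.Basis ι R M) (π : R) :
    Function.Surjective (redCoord b π) := by
  cases nonempty_fintype ι
  intro x
  choose c hc using fun i => Ideal.Quotient.mk_surjective (x i)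
  refine ⟨∑ i, c i • b i, funext fun i => ?_⟩
  rw [redCoord_apply, b.repr_sum_self, hc]

theorem linIndepMod_iff {ι κ : Type*} [Fintype ι] [Finite κ] (b : Module.Basis κ R M) {π : R}
    {x : ι → M} :
    LinIndepMod π x ↔ LinearIndependent (R ⧸ Ideal.span {π}) fun i => redCoord b π (x i) := by
  rw [Fintype.linearIndependent_iff]
  refine ⟨fun h w hw i => ?_, fun h c z hz i =>
    mk_eq_zero_iff_dvd.mp (h (fun j => Ideal.Quotient.mk _ (c j)) ?_ i)⟩
  · choose c hc using fun i => Ideal.Quotient.mk_surjective (w i)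
    simp only [← hc, ← redCoord_sum] at hw
    obtain ⟨z, hz⟩ := (redCoord_eq_zero_iff b).mp hw
    rw [← hc, mk_eq_zero_iff_dvd]
    exact h c z hz i
  · rw [← redCoord_sum]
    exact (redCoord_eq_zero_iff b).mpr ⟨z, hz⟩

/-- The reduction of a linear map modulo `π`, in coordinates. -/
def redMap {ι κ : Type*} [Fintype ι] (b : Module.Basis ι R M) (b' : Module.Basis κ R N) (π : R)
    (f : M →ₗ[R] N) :
    (ι → R ⧸ Ideal.span {π}) →ₗ[R ⧸ Ideal.span {π}] (κ → R ⧸ Ideal.span {π}) :=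
  Fintype.linearCombination _ fun i => redCoord b' π (f (b i))

theorem redMap_redCoord {ι κ : Type*} [Fintype ι] (b : Module.Basis ι R M)
    (b' : Module.Basis κ R N) (π : R) (f : M →ₗ[R] N) (x : M) :
    redMap b b' π f (redCoord b π x) = redCoord b' π (f x) := by
  conv_rhs => rw [← b.sum_repr x, map_sum]
  simp only [map_smul]
  rw [redCoord_sum, redMap, Fintype.linearCombination_apply]
  rfl

theorem ker_redMap_le {α β γ : Type*} [Fintype α] [Fintype β] [Finite γ]
    (bP : Module.Basis α R P) (bM : Module.Basis β R M) (bN : Module.Basis γ R N)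
    {π : R} {f : P →ₗ[R] M} {g : M →ₗ[R] N}
    (h : ∀ x z, g x = π • z → ∃ b x', x = f b + π • x') :
    LinearMap.ker (redMap bM bN π g) ≤ LinearMap.range (redMap bP bM π f) := by
  intro x hx
  obtain ⟨x, rfl⟩ := redCoord_surjective bM π x
  rw [LinearMap.mem_ker, redMap_redCoord, redCoord_eq_zero_iff] at hx
  obtain ⟨z, hz⟩ := hx
  obtain ⟨p, x', rfl⟩ := h x z hz
  refine ⟨redCoord bP π p, ?_⟩
  rw [redMap_redCoord, map_add, (redCoord_eq_zero_iff bM).mpr ⟨x', rfl⟩, add_zero]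

theorem exists_linIndepMod_of_le_finrank {β γ : Type*} [Fintype β] [Finite γ]
    (bM : Module.Basis β R M) (bN : Module.Basis γ R N) {π : R} {g : M →ₗ[R] N} {n : ℕ}
    (hn : n ≤ Module.finrank (R ⧸ Ideal.span {π}) (LinearMap.range (redMap bM bN π g))) :
    ∃ ψ : Fin n → M, LinIndepMod π (g ∘ ψ) := by
  obtain ⟨y, hy⟩ := exists_linearIndependent_of_le_finrank hn
  choose x hx using fun i => (y i).2
  choose ψ hψ using fun i => redCoord_surjective bM π (x i)
  refine ⟨ψ, (linIndepMod_iff bN).mpr ?_⟩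
  simp only [Function.comp_apply, ← redMap_redCoord bM bN, hψ, hx]
  exact hy.map' (Submodule.subtype _) (Submodule.ker_subtype _)

theorem exists_linIndepMod [IsDomain R] [Module.Free R M] [Module.Finite R M] [Module.Free R N]
    [Module.Finite R N] [Module.Free R P] [Module.Finite R P] {π : R} (hπ : π = 0 ∨ Prime π)
    {f : P →ₗ[R] M} {g : M →ₗ[R] N} (h : ∀ x z, g x = π • z → ∃ b x', x = f b + π • x') {n : ℕ}
    (hn : n + Module.finrank R P ≤ Module.finrank R M) :
    ∃ ψ : Fin n → M, LinIndepMod π (g ∘ ψ) := by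
  have := isPrime_span_of_zero_or_prime hπ
  let bP := Module.finBasis R P
  let bM := Module.finBasis R M
  let bN := Module.finBasis R N
  have hrange_ker := finrank_range_add_finrank_ker_of_isDomain (redMap bM bN π g)
  have hker := Submodule.finrank_mono (ker_redMap_le bP bM bN h)
  have hrange := LinearMap.finrank_range_le (redMap bP bM π f)
  rw [Module.finrank_fin_fun] at hrange_ker hrange
  exact exists_linIndepMod_of_le_finrank bM bN (by omega)

theorem LinIndepMod.not_dvd_det [IsDomain R] {ι : Type*} [Fintype ι] [DecidableEq ι] {π : R}
    (hπ : π = 0 ∨ Prime π) {x : ι → M} (hx : LinIndepMod π x) (b : Module.Basis ι R M) :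
    ¬ π ∣ b.det x := by
  have := isPrime_span_of_zero_or_prime hπ
  rw [← mk_eq_zero_iff_dvd, Module.Basis.det_apply, RingHom.map_det,
    ← Matrix.exists_mulVec_eq_zero_iff]
  rintro ⟨w, hw, hmul⟩
  refine hw (Matrix.mulVec_injective_iff.mpr ?_ (hmul.trans (Matrix.mulVec_zero _).symm))
  exact (linIndepMod_iff b).mp hx

theorem exists_dual_of_linearIndependent {K V ι : Type*} [Field K] [AddCommGroup V] [Module K V]
    [DecidableEq ι] {x : ι → V} (hx : LinearIndependent K x) :
    ∃ g : ι → Module.Dual K V, ∀ i j, g j (x i) = if i = j then 1 else 0 := by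
  obtain ⟨g, hg⟩ := LinearMap.exists_leftInverse_of_injective _
    (LinearMap.ker_eq_bot.mpr hx)
  refine ⟨fun j => Finsupp.lapply j ∘ₗ g, fun i j => ?_⟩
  have h := LinearMap.congr_fun hg (Finsupp.single i 1)
  rw [LinearMap.comp_apply, Finsupp.linearCombination_single, one_smul, LinearMap.id_apply] at h
  rw [LinearMap.comp_apply, h, Finsupp.lapply_apply, Finsupp.single_apply]

theorem exists_dotProduct_of_linearIndependent [IsDomain R] {ι κ : Type*} [Finite ι] [Fintype κ]
    [DecidableEq ι] {x : ι → κ → R} (hx : LinearIndependent R x) :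
    ∃ (t : ι → κ → R) (d : R), d ≠ 0 ∧ ∀ i j, t j ⬝ᵥ x i = if i = j then d else 0 := by
  classical
  let K := FractionRing R
  have hxK : LinearIndependent K fun i k => algebraMap R K (x i k) := by
    rw [← LinearIndependent.iff_fractionRing R K]
    exact hx.map' (LinearMap.compLeft (Algebra.linearMap R K) κ)
      (LinearMap.ker_eq_bot.mpr (IsFractionRing.injective R K).comp_left)
  obtain ⟨g, hg⟩ := exists_dual_of_linearIndependent hxK
  obtain ⟨d, hd⟩ := IsLocalization.exist_integer_multiples_of_finite (nonZeroDivisors R)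
    fun p : ι × κ => g p.1 (Pi.single p.2 1)
  choose t ht using hd
  refine ⟨fun j k => t (j, k), d, nonZeroDivisors.ne_zero d.2, fun i j => ?_⟩
  apply IsFractionRing.injective R K
  have hsum : g j (fun k => algebraMap R K (x i k)) =
      ∑ k, g j (Pi.single k 1) * algebraMap R K (x i k) := by
    rw [LinearMap.pi_apply_eq_sum_univ (g j)]
    exact Finset.sum_congr rfl fun k _ => by rw [smul_eq_mul, mul_comm]; congr 2; grind
  calc algebraMap R K (∑ k, t (j, k) * x i k)
      = algebraMap R K d * ∑ k, g j (Pi.single k 1) * algebraMap R K (x i k) := by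
        simp only [map_sum, map_mul, ht, Algebra.smul_def, Finset.mul_sum, mul_assoc]
    _ = algebraMap R K (if i = j then d else 0) := by
        rw [← hsum, hg, mul_ite, mul_one, mul_zero, apply_ite (algebraMap R K), map_zero]

theorem sum_adjugate_smul_apply {ι : Type*} [Fintype ι] [DecidableEq ι]
    (φ : ι → Module.Dual R M) (x : ι → M) (i j : ι) :
    (∑ k, (Matrix.of fun i j => φ j (x i)).adjugate k j • φ k) (x i) =
      if i = j then (Matrix.of fun i j => φ j (x i)).det else 0 := by
  have h := congrFun (congrFun (Matrix.mul_adjugate (Matrix.of fun i j => φ j (x i))) i) j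
  rw [Matrix.smul_apply, Matrix.one_apply, smul_eq_mul, mul_ite, mul_one, mul_zero] at h
  rw [← h, Matrix.mul_apply, LinearMap.sum_apply]
  exact Finset.sum_congr rfl fun k _ => mul_comm _ _

theorem LinIndepMod.exists_dual [IsDomain R] [Module.Free R M] [Module.Finite R M] {π : R}
    (hπ : π = 0 ∨ Prime π) {ι : Type*} [Fintype ι] [DecidableEq ι] {x : ι → M}
    (hx : LinIndepMod π x) :
    ∃ (φ : ι → Module.Dual R M) (y : R), ¬ π ∣ y ∧ ∀ i j, φ j (x i) = if i = j then y else 0 := by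
  have := isPrime_span_of_zero_or_prime hπ
  let b := Module.finBasis R M
  obtain ⟨t, d, hd, htd⟩ := exists_dotProduct_of_linearIndependent ((linIndepMod_iff b).mp hx)
  choose T hT using fun j k => Ideal.Quotient.mk_surjective (t j k)
  let φ (j : ι) : Module.Dual R M := ∑ k, T j k • b.coord k
  refine ⟨_, _, ?_, sum_adjugate_smul_apply φ x⟩
  have hmap : (Matrix.of fun i j => φ j (x i)).map (Ideal.Quotient.mk (Ideal.span {π})) =
      d • (1 : Matrix ι ι (R ⧸ Ideal.span {π})) := by
    ext i j
    rw [Matrix.map_apply, Matrix.of_apply, Matrix.smul_apply, Matrix.one_apply, smul_eq_mul,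
      mul_ite, mul_one, mul_zero, ← htd i j, LinearMap.sum_apply, map_sum]
    refine Finset.sum_congr rfl fun k _ => ?_
    rw [LinearMap.smul_apply, smul_eq_mul, map_mul, hT]
    rfl
  rw [← mk_eq_zero_iff_dvd, RingHom.map_det, RingHom.mapMatrix_apply, hmap, Matrix.det_smul,
    Matrix.det_one, mul_one]
  exact pow_ne_zero _ hd

end ModularRank

section Alternating

variable {R M N ι : Type*} [CommRing R] [AddCommGroup M] [Module R M] [AddCommGroup N] [Module R N]
  [Finite ι]

theorem alternatingMap_eq_zero_of_mem_span {Δ : M [⋀^ι]→ₗ[R] N} {w : ι → M} (hw : Δ w = 0)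
    {u : ι → M} (hu : ∀ i, u i ∈ Submodule.span R (Set.range w)) : Δ u = 0 := by
  classical
  cases nonempty_fintype ι
  choose c hc using fun i => (Submodule.mem_span_range_iff_exists_fun R).mp (hu i)
  suffices h : Δ.compLinearMap (Fintype.linearCombination R w) = 0 by
    rw [← funext hc]
    exact congrArg (· c) h
  refine Module.Basis.ext_alternating (Pi.basisFun R ι) fun σ hσ => ?_
  have hperm : (fun i => Fintype.linearCombination R w (Pi.basisFun R ι (σ i))) =
      w ∘ Equiv.ofBijective σ (Finite.injective_iff_bijective.mp hσ) := by
    funext i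
    simp
  exact (congrArg Δ hperm).trans (by rw [AlternatingMap.map_perm, hw, smul_zero]; rfl)

variable [IsDomain R] [Module.IsTorsionFree R N] {S : Submodule R M} {w : ι → M}
  (hw : ∀ x, ∃ r : R, r ≠ 0 ∧ r • x ∈ Submodule.span R (Set.range w) ⊔ S)

include hw

theorem alternatingMap_eq_zero_of_smul_mem_span_sup {Δ : M [⋀^ι]→ₗ[R] N}
    (hS : ∀ u i, u i ∈ S → Δ u = 0) (hΔ : Δ w = 0) : Δ = 0 := by
  classical
  cases nonempty_fintype ι
  ext u
  choose r hr h using fun i => hw (u i)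
  choose s hs t ht hst using fun i => Submodule.mem_sup.mp (h i)
  have hprod : (∏ i, r i) • Δ u = Δ (s + t) := by
    rw [show s + t = fun i => r i • u i from funext hst]
    exact (Δ.toMultilinearMap.map_smul_univ r u).symm
  have hsum : Δ (s + t) = 0 := by
    refine (Δ.toMultilinearMap.map_add_univ s t).trans (Finset.sum_eq_zero fun J _ => ?_)
    by_cases hJ : ∀ i, i ∈ J
    · exact alternatingMap_eq_zero_of_mem_span hΔ fun i => by
        rw [Finset.piecewise_eq_of_mem _ _ _ (hJ i)]
        exact hs i
    · obtain ⟨i, hi⟩ := not_forall.mp hJ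
      refine hS _ i ?_
      rw [Finset.piecewise_eq_of_notMem _ _ _ hi]
      exact ht i
  exact (smul_eq_zero.mp (hprod.trans hsum)).resolve_left
    (Finset.prod_ne_zero_iff.mpr fun i _ => hr i)

theorem alternatingMap_smul_eq_smul (F : M [⋀^ι]→ₗ[R] R) (G : M [⋀^ι]→ₗ[R] N)
    (hF : ∀ u i, u i ∈ S → F u = 0) (hG : ∀ u i, u i ∈ S → G u = 0) (u : ι → M) :
    F w • G u = F u • G w := by
  have h : F w • G - (LinearMap.toSpanSingleton R N (G w)).compAlternatingMap F = 0 :=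
    alternatingMap_eq_zero_of_smul_mem_span_sup hw
      (fun u i hi => by simp [hF u i hi, hG u i hi]) (by simp)
  exact sub_eq_zero.mp (congrArg (· u) h)

end Alternating

section Multiples

variable {R M ι : Type*} [CommRing R] [IsDomain R] [UniqueFactorizationMonoid R]
  [AddCommGroup M] [Module R M] [Module.Free R M] [Module.Finite R M]

theorem exists_eq_smul_of_forall_smul {D : ι → R} (hD : ∀ π, Prime π → ∃ i, ¬ π ∣ D i) {d : R}
    (hd : d ≠ 0) {g : M} (hg : ∀ i, ∃ m, D i • g = d • m) : ∃ m, g = d • m := by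
  induction d using UniqueFactorizationMonoid.induction_on_prime generalizing g with
  | h₁ => exact absurd rfl hd
  | h₂ u hu =>
    obtain ⟨u, rfl⟩ := hu
    exact ⟨(↑u⁻¹ : R) • g, by rw [smul_smul, Units.mul_inv, one_smul]⟩
  | h₃ d π hd' hπ ih =>
    obtain ⟨i, hi⟩ := hD π hπ
    obtain ⟨m, hm⟩ := hg i
    rw [mul_smul] at hm
    obtain ⟨g', rfl⟩ := exists_eq_smul_of_smul_eq_smul (Or.inr hπ) hi hm
    obtain ⟨m', rfl⟩ := ih hd' (g := g') fun j => by
      obtain ⟨m, hm⟩ := hg j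
      rw [smul_comm, mul_smul] at hm
      exact ⟨m, (smul_right_injective M hπ.ne_zero) hm⟩
    exact ⟨m', by rw [mul_smul]⟩

theorem IsPrimitive.exists_units_smul_eq {F G : M} (hF : IsPrimitive R F)
    (hG : IsPrimitive R G) (hF0 : F ≠ 0) {c d : R} (hc : c ≠ 0) (hd : d ≠ 0)
    (h : c • G = d • F) : ∃ ε : Rˣ, F = (ε : R) • G := by
  obtain ⟨c', hc'⟩ := hF.exists_eq_smul hc h
  obtain ⟨d', hd'⟩ := hG.exists_eq_smul hd h.symm
  have hu : d' * c' = 1 := by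
    refine smul_left_injective R hF0 ?_
    simp only [mul_smul, ← hc', ← hd', one_smul]
  exact ⟨⟨d', c', hu, by rw [mul_comm, hu]⟩, hd'⟩

end Multiples

section Determinant

variable {R M : Type*} [CommRing R] [AddCommGroup M] [Module R M] {n r : ℕ}

/-- The determinant as an alternating function of the first vectors, the other ones being fixed. -/
def detLeft (c : Module.Basis (Fin n ⊕ Fin r) R M) (x : Fin r → M) : M [⋀^Fin n]→ₗ[R] R where
  toFun u := c.det (Sum.elim u x)
  map_update_add' u i z z' := by
    simp only [Sum.elim_update_left, AlternatingMap.map_update_add]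
  map_update_smul' u i a z := by
    simp only [Sum.elim_update_left, AlternatingMap.map_update_smul]
  map_eq_zero_of_eq' u i j h hij :=
    c.det.map_eq_zero_of_eq (Sum.elim u x) (i := Sum.inl i) (j := Sum.inl j) (by simpa using h)
      (by simpa using hij)

theorem detLeft_eq_zero [IsDomain R] (c : Module.Basis (Fin n ⊕ Fin r) R M) {x : Fin r → M}
    {u : Fin n → M} {i : Fin n} (hi : u i ∈ Submodule.span R (Set.range x)) :
    detLeft c x u = 0 := by
  classical
  refine c.det.map_linearDependent _ ?_
  obtain ⟨a, ha⟩ := (Submodule.mem_span_range_iff_exists_fun R).mp hi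
  rw [Fintype.not_linearIndependent_iff]
  refine ⟨Sum.elim (Pi.single i (-1)) a, ?_, Sum.inl i, by simp⟩
  rw [Fintype.sum_sum_type]
  simp only [Sum.elim_inl, Sum.elim_inr, ha]
  rw [Fintype.sum_eq_single i fun j hj => by rw [Pi.single_eq_of_ne hj, zero_smul]]
  simp

end Determinant

section Frames

variable {R H : Type*} [CommRing R] [AddCommGroup H] [Module R H]

theorem isFrame_of_isotropic {ι : Type*} [Fintype ι] [DecidableEq ι] {l v : ι → Hyp R H} {y : R}
    (hl : ∀ i j, ⟪l i, l j⟫ = 0) (hv : ∀ i j, ⟪l i, v j⟫ = if i = j then y else 0) :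
    IsFrame l (fun j => (2 * y) • v j - ∑ k, ⟪v k, v j⟫ • l k) (2 * y * y) where
  left := hl
  right i j := by
    have hv' (i j) : ⟪v j, l i⟫ = if i = j then y else 0 := by rw [dualProd_comm, hv]
    simp only [map_sub, map_smul, map_sum, LinearMap.sub_apply, LinearMap.smul_apply,
      LinearMap.sum_apply, hl, hv, hv', smul_eq_mul, mul_ite, mul_zero, Finset.mem_univ, if_true,
      Finset.sum_const_zero, sub_zero, Finset.sum_ite_eq', dualProd_comm (v j) (v i)]
    ring
  pair i j := by
    simp only [map_sub, map_smul, map_sum, hl, hv, smul_eq_mul, mul_ite, mul_zero,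
      Finset.sum_const_zero, sub_zero]

theorem wedgePairing_ιMulti {n : ℕ} (x u : Fin n → Hyp R H) :
    wedgePairing R H n (exteriorPower.ιMulti R n x) (exteriorPower.ιMulti R n u) =
      Matrix.det (Matrix.of fun i j => ⟪x j, u i⟫) := by
  rw [wedgePairing, LinearMap.comp_apply, exteriorPower.map_apply_ιMulti,
    exteriorPower.pairingDual_ιMulti_ιMulti]
  rfl

theorem IsFrame.wedgePairing {n : ℕ} {l v : Fin n → Hyp R H} {y : R} (hf : IsFrame l v y) :
    SpinorRes.wedgePairing R H n (exteriorPower.ιMulti R n l) (exteriorPower.ιMulti R n v) =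
      y ^ n := by
  have hdiag : (Matrix.of fun i j => ⟪l j, v i⟫) = Matrix.diagonal fun _ => y := by
    ext i j
    rw [Matrix.of_apply, Matrix.diagonal_apply, hf.pair]
    simp only [eq_comm]
  rw [wedgePairing_ιMulti, hdiag, Matrix.det_diagonal, Finset.prod_const, Finset.card_univ,
    Fintype.card_fin]

end Frames

section Resolution

variable {R B₀ B₁ H : Type*} [CommRing R]
  [AddCommGroup B₀] [Module R B₀] [AddCommGroup B₁] [Module R B₁]
  [AddCommGroup H] [Module R H] [Module.Free R H] [Module.Finite R H]
  {δ₁ : B₁ →ₗ[R] B₀} {δ₂ : Hyp R H →ₗ[R] B₁}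

theorem dualProd_delta3 (δ₂ : Hyp R H →ₗ[R] B₁) (φ : Module.Dual R B₁) (x : Hyp R H) :
    ⟪delta3 δ₂ φ, x⟫ = φ (δ₂ x) := by
  have h₂ : x.1 (delta3 δ₂ φ).2 = φ (δ₂ (x.1, 0)) :=
    Module.apply_evalEquiv_symm_apply R H x.1
      ((δ₂.comp (LinearMap.inl R (Module.Dual R H) H)).dualMap φ)
  have h₁ : (delta3 δ₂ φ).1 x.2 = φ (δ₂ (0, x.2)) := rfl
  rw [dualProd_eq_add, h₁, h₂, ← map_add, ← map_add]
  simp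

theorem dualProd_surjective : Function.Surjective (LinearMap.dualProd R H) := by
  intro φ
  refine ⟨(φ ∘ₗ LinearMap.inr R _ H, (Module.evalEquiv R H).symm (φ ∘ₗ LinearMap.inl R _ H)),
    LinearMap.ext fun x => ?_⟩
  rw [dualProd_eq_add, Module.apply_evalEquiv_symm_apply]
  simp only [LinearMap.comp_apply, LinearMap.inr_apply, LinearMap.inl_apply]
  rw [← map_add]
  simp

namespace IsSelfDualResolution

variable (hB : IsSelfDualResolution δ₁ δ₂)

include hB

theorem delta3_delta4 (x : Module.Dual R B₀) : delta3 δ₂ (delta4 δ₁ x) = 0 :=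
  (hB.exact₃ _).mpr ⟨x, rfl⟩

theorem delta2_delta3 (φ : Module.Dual R B₁) : δ₂ (delta3 δ₂ φ) = 0 :=
  (hB.exact₂ _).mpr ⟨φ, rfl⟩

theorem dualProd_delta3_delta3 (φ ψ : Module.Dual R B₁) : ⟪delta3 δ₂ φ, delta3 δ₂ ψ⟫ = 0 := by
  rw [dualProd_delta3, hB.delta2_delta3, map_zero]

section Domain

variable [IsDomain R] {π : R}

theorem exists_delta3_eq_of_smul [Module.IsTorsionFree R B₁] {z : Hyp R H} (hπ : π ≠ 0)
    {φ : Module.Dual R B₁} (h : delta3 δ₂ φ = π • z) : ∃ φ', delta3 δ₂ φ' = z := by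
  refine (hB.exact₂ z).mp ((smul_eq_zero.mp ?_).resolve_left hπ)
  rw [← map_smul, ← h, hB.delta2_delta3]

theorem exists_delta4_add_smul_of_delta3_eq_smul [Module.IsTorsionFree R B₁]
    {φ : Module.Dual R B₁} {z : Hyp R H} (h : delta3 δ₂ φ = π • z) :
    ∃ b φ', φ = delta4 δ₁ b + π • φ' := by
  rcases eq_or_ne π 0 with rfl | hπ
  · rw [zero_smul] at h
    obtain ⟨b, hb⟩ := (hB.exact₃ φ).mp h
    exact ⟨b, 0, by rw [hb, smul_zero, add_zero]⟩
  · obtain ⟨φ', rfl⟩ := hB.exists_delta3_eq_of_smul hπ h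
    rw [← map_smul, ← sub_eq_zero, ← map_sub] at h
    obtain ⟨b, hb⟩ := (hB.exact₃ _).mp h
    exact ⟨b, φ', by rw [hb, sub_add_cancel]⟩

theorem exists_eq_smul_of_delta4_eq_smul {x : Module.Dual R B₀} {φ : Module.Dual R B₁}
    (h : delta4 δ₁ x = π • φ) : ∃ x', x = π • x' := by
  rcases eq_or_ne π 0 with rfl | hπ
  · rw [zero_smul] at h
    exact ⟨0, by rw [smul_zero]; exact hB.injective (by rw [h, map_zero])⟩
  · have hφ : π • delta3 δ₂ φ = 0 := by rw [← map_smul, ← h, hB.delta3_delta4]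
    obtain ⟨b, rfl⟩ := (hB.exact₃ φ).mp ((smul_eq_zero.mp hφ).resolve_left hπ)
    exact ⟨b, hB.injective (by rw [h, map_smul])⟩

theorem linIndepMod_sumElim {n r : ℕ} {ψ : Fin n → Module.Dual R B₁}
    (hψ : LinIndepMod π (delta3 δ₂ ∘ ψ)) (b : Module.Basis (Fin r) R (Module.Dual R B₀)) :
    LinIndepMod π (Sum.elim ψ fun j => delta4 δ₁ (b j)) := by
  intro c z h
  rw [Fintype.sum_sum_type] at h
  simp only [Sum.elim_inl, Sum.elim_inr] at h
  have hl : ∀ i, π ∣ c (Sum.inl i) := by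
    refine hψ (fun i => c (Sum.inl i)) (delta3 δ₂ z) ?_
    simpa [hB.delta3_delta4] using congrArg (delta3 δ₂) h
  choose c' hc' using hl
  have hr : delta4 δ₁ (∑ j, c (Sum.inr j) • b j) = π • (z - ∑ i, c' i • ψ i) := by
    rw [smul_sub, ← h, map_sum, Finset.smul_sum]
    simp only [map_smul, smul_smul, ← hc']
    abel
  obtain ⟨x', hx'⟩ := hB.exists_eq_smul_of_delta4_eq_smul hr
  rintro (i | j)
  · exact ⟨c' i, hc' i⟩
  · have hj := congrArg (b.repr · j) hx'
    simp only [b.repr_sum_self, map_smul, Finsupp.smul_apply, smul_eq_mul] at hj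
    exact ⟨_, hj⟩

theorem exists_isFrame [Invertible (2 : R)] [Module.Free R B₀] [Module.Finite R B₀]
    [Module.Free R B₁] [Module.Finite R B₁] {n : ℕ}
    (hn : n + Module.finrank R B₀ ≤ Module.finrank R B₁) (hπ : π = 0 ∨ Prime π) :
    ∃ (ψ : Fin n → Module.Dual R B₁) (v : Fin n → Hyp R H) (y : R),
      IsFrame (delta3 δ₂ ∘ ψ) v y ∧ ¬ π ∣ y ∧ LinIndepMod π (delta3 δ₂ ∘ ψ) := by
  obtain ⟨ψ, hψ⟩ := exists_linIndepMod hπ (f := delta4 δ₁) (g := delta3 δ₂)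
    (fun x z h => hB.exists_delta4_add_smul_of_delta3_eq_smul h) (n := n)
    (by simpa [Module.finrank_linearMap] using hn)
  obtain ⟨φ, y, hy, hφ⟩ := hψ.exists_dual hπ
  choose v hv using fun j => dualProd_surjective (φ j)
  refine ⟨ψ, _, _, isFrame_of_isotropic (v := v) (y := y)
    (fun i j => hB.dualProd_delta3_delta3 _ _)
    (fun i j => by rw [dualProd_comm, hv, hφ]), fun h => ?_, hψ⟩
  have h2 : ¬ π ∣ 2 := fun h2 => hy (h2.trans (isUnit_of_invertible (2 : R)).dvd)
  exact (dvd_or_dvd_of_zero_or_prime hπ h).elim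
    (fun h => (dvd_or_dvd_of_zero_or_prime hπ h).elim h2 hy) hy

variable {n r : ℕ} (hn : Module.finrank R H = n) {ψ : Fin n → Module.Dual R B₁}
  {v : Fin n → Hyp R H} {y : R} (hf : IsFrame (delta3 δ₂ ∘ ψ) v y) (hy : y ≠ 0)

include hn hf hy

theorem smul_mem_span_sup_range_delta4 (φ : Module.Dual R B₁) :
    y • φ ∈ Submodule.span R (Set.range ψ) ⊔ LinearMap.range (delta4 δ₁) := by
  have h := hf.smul_eq hy (by simpa using hn) (delta3 δ₂ φ)
  simp only [Function.comp_apply, hB.dualProd_delta3_delta3, zero_smul, Finset.sum_const_zero,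
    zero_add] at h
  have hker : y • φ - ∑ j, ⟪v j, delta3 δ₂ φ⟫ • ψ j ∈ LinearMap.range (delta4 δ₁) :=
    (hB.exact₃ _).mp (by simp [h])
  rw [← add_sub_cancel (∑ j, ⟪v j, delta3 δ₂ φ⟫ • ψ j) (y • φ)]
  exact Submodule.add_mem_sup (Submodule.sum_mem _ fun j _ =>
    Submodule.smul_mem _ _ (Submodule.subset_span ⟨j, rfl⟩)) hker

theorem det_smul_ιMulti_delta3 (b : Module.Basis (Fin r) R (Module.Dual R B₀))
    (c : Module.Basis (Fin n ⊕ Fin r) R (Module.Dual R B₁)) (u : Fin n → Module.Dual R B₁) :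
    c.det (Sum.elim ψ fun j => delta4 δ₁ (b j)) •
        exteriorPower.ιMulti R n (fun i => delta3 δ₂ (u i)) =
      c.det (Sum.elim u fun j => delta4 δ₁ (b j)) •
        exteriorPower.ιMulti R n fun i => delta3 δ₂ (ψ i) := by
  refine alternatingMap_smul_eq_smul (S := LinearMap.range (delta4 δ₁))
    (fun φ => ⟨y, hy, hB.smul_mem_span_sup_range_delta4 hn hf hy φ⟩)
    (detLeft c fun j => delta4 δ₁ (b j))
    ((exteriorPower.ιMulti R n (M := Hyp R H)).compLinearMap (delta3 δ₂))
    (fun u i hi => detLeft_eq_zero c (i := i) ?_) (fun u i hi => ?_) u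
  · obtain ⟨z, hz⟩ := hi
    rw [← hz, ← b.sum_repr z, map_sum]
    refine Submodule.sum_mem _ fun j _ => ?_
    rw [map_smul]
    exact Submodule.smul_mem _ _ (Submodule.subset_span ⟨j, rfl⟩)
  · obtain ⟨z, hz⟩ := hi
    refine (exteriorPower.ιMulti R n).map_coord_zero i ?_
    rw [← hz, hB.delta3_delta4]

end Domain

end IsSelfDualResolution

end Resolution

section Multiplier

variable {R B₀ B₁ H : Type*} [CommRing R] [IsDomain R]
  [AddCommGroup B₀] [Module R B₀] [AddCommGroup B₁] [Module R B₁]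
  [AddCommGroup H] [Module R H] [Module.Free R H] [Module.Finite R H]
  {δ₁ : B₁ →ₗ[R] B₀} {δ₂ : Hyp R H →ₗ[R] B₁} {n r : ℕ} {a₃ : ⋀[R]^n (Hyp R H)}

theorem IsMultiplier.not_dvd_wedgePairing (ha : IsMultiplier n r δ₁ δ₂ a₃)
    {ψ : Fin n → Module.Dual R B₁} {v : Fin n → Hyp R H} {y : R}
    (hf : IsFrame (delta3 δ₂ ∘ ψ) v y) {π : R} (hπ : π = 0 ∨ Prime π) (hy : ¬ π ∣ y) :
    ¬ π ∣ wedgePairing R H n a₃ (exteriorPower.ιMulti R n v) := by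
  obtain ⟨b, c, h⟩ := ha
  have hpow := hf.wedgePairing
  rw [show delta3 δ₂ ∘ ψ = fun i => delta3 δ₂ (ψ i) from rfl, h ψ, map_smul, LinearMap.smul_apply,
    smul_eq_mul] at hpow
  intro hdvd
  exact hy (dvd_of_dvd_pow_of_zero_or_prime hπ (hpow ▸ hdvd.mul_left _))

variable [Module.Free R B₀] [Module.Finite R B₀] [Module.Free R B₁] [Module.Finite R B₁]
  [Invertible (2 : R)]

theorem IsMultiplier.wedgePairing_eq_zero (ha : IsMultiplier n r δ₁ δ₂ a₃)
    (hB : IsSelfDualResolution δ₁ δ₂)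
    (hnr : n + Module.finrank R B₀ ≤ Module.finrank R B₁) {u : Fin n → Hyp R H} {i : Fin n}
    (hi : u i ∈ LinearMap.range (delta3 δ₂)) :
    wedgePairing R H n a₃ (exteriorPower.ιMulti R n u) = 0 := by
  obtain ⟨b, c, h⟩ := ha
  obtain ⟨ψ, -, -, -, -, hψ⟩ := hB.exists_isFrame hnr (Or.inl rfl)
  have hdet := (hB.linIndepMod_sumElim hψ b).not_dvd_det (Or.inl rfl) c
  rw [zero_dvd_iff] at hdet
  have hwedge := congrArg (wedgePairing R H n · (exteriorPower.ιMulti R n u)) (h ψ)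
  simp only [map_smul, LinearMap.smul_apply, wedgePairing_ιMulti] at hwedge
  obtain ⟨φ, hφ⟩ := hi
  rw [Matrix.det_eq_zero_of_row_eq_zero i fun j => by
    rw [Matrix.of_apply, ← hφ, hB.dualProd_delta3_delta3]] at hwedge
  exact (smul_eq_zero.mp hwedge.symm).resolve_left hdet

variable [UniqueFactorizationMonoid R]

theorem IsSelfDualResolution.exists_isMultiplier (hB : IsSelfDualResolution δ₁ δ₂)
    (hn : Module.finrank R H = n) (hr : Module.finrank R B₀ = r)
    (hnr : Module.finrank R B₁ = n + r) : ∃ a₃, IsMultiplier n r δ₁ δ₂ a₃ := by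
  let b : Module.Basis (Fin r) R (Module.Dual R B₀) :=
    Module.finBasisOfFinrankEq R _ (by simpa [Module.finrank_linearMap] using hr)
  let c : Module.Basis (Fin n ⊕ Fin r) R (Module.Dual R B₁) :=
    (Module.finBasisOfFinrankEq R _ (by simpa [Module.finrank_linearMap] using hnr)).reindex
      finSumFinEquiv.symm
  let D (u : Fin n → Module.Dual R B₁) : R := c.det (Sum.elim u fun j => delta4 δ₁ (b j))
  have hframe (π : R) (hπ : π = 0 ∨ Prime π) : ∃ (ψ : Fin n → Module.Dual R B₁)
      (v : Fin n → Hyp R H) (y : R), IsFrame (delta3 δ₂ ∘ ψ) v y ∧ ¬ π ∣ y ∧ ¬ π ∣ D ψ := by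
    obtain ⟨ψ, v, y, hf, hy, hψ⟩ := hB.exists_isFrame (n := n) (by lia) hπ
    exact ⟨ψ, v, y, hf, hy, (hB.linIndepMod_sumElim hψ b).not_dvd_det hπ c⟩
  obtain ⟨ψ, v, y, hf, hy, hψ⟩ := hframe 0 (Or.inl rfl)
  rw [zero_dvd_iff] at hy hψ
  have hD := hB.det_smul_ιMulti_delta3 hn hf hy b c
  obtain ⟨a₃, ha₃⟩ := exists_eq_smul_of_forall_smul (D := D)
    (fun π hπ => (hframe π (Or.inr hπ)).imp fun ψ h => h.choose_spec.choose_spec.2.2) hψ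
    (g := exteriorPower.ιMulti R n fun i => delta3 δ₂ (ψ i)) fun u => ⟨_, (hD u).symm⟩
  refine ⟨a₃, b, c, fun u => smul_right_injective _ hψ ?_⟩
  have h := hD u
  rwa [ha₃, smul_comm] at h

theorem IsMultiplier.exists_spinorP_eq_smul (ha : IsMultiplier n r δ₁ δ₂ a₃)
    (hB : IsSelfDualResolution δ₁ δ₂) (hn : Module.finrank R H = n)
    (hnr : n + Module.finrank R B₀ ≤ Module.finrank R B₁) (e : Module.Basis (Fin n) R H)
    {s : ExteriorAlgebra R H} (hs0 : s ≠ 0) (hp : IsPrimitive R s)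
    (hs : ∀ φ, spinorAct R H (delta3 δ₂ φ) s = 0) :
    ∃ ε : Rˣ, spinorP e s s = (ε : R) • wedgePairing R H n a₃ := by
  have hframe (π : R) (hπ : π = 0 ∨ Prime π) : ∃ (ψ : Fin n → Module.Dual R B₁)
      (v : Fin n → Hyp R H) (y : R), IsFrame (delta3 δ₂ ∘ ψ) v y ∧ ¬ π ∣ y ∧
        ¬ π ∣ spinorP e s s (exteriorPower.ιMulti R n v) ∧
        ¬ π ∣ wedgePairing R H n a₃ (exteriorPower.ιMulti R n v) := by
    obtain ⟨ψ, v, y, hf, hy, -⟩ := hB.exists_isFrame (n := n) hnr hπ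
    refine ⟨ψ, v, y, hf, hy, ?_, ha.not_dvd_wedgePairing hf hπ hy⟩
    rw [spinorP_ιMulti_of_orthogonal e s s hf.right]
    exact hf.not_dvd_spinorForm_actProd e hπ hy hs0 hp fun i => hs (ψ i)
  have hP : IsPrimitive R (spinorP e s s) := by
    rintro π hπ F hF
    obtain ⟨_, v, _, _, _, h, -⟩ := hframe π (Or.inr hπ)
    exact h ⟨F _, by rw [hF]; rfl⟩
  have hW : IsPrimitive R (wedgePairing R H n a₃) := by
    rintro π hπ F hF
    obtain ⟨_, v, _, _, _, -, h⟩ := hframe π (Or.inr hπ)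
    exact h ⟨F _, by rw [hF]; rfl⟩
  obtain ⟨ψ, v, y, hf, hy, hPv, hWv⟩ := hframe 0 (Or.inl rfl)
  rw [zero_dvd_iff] at hy hPv hWv
  refine hP.exists_units_smul_eq hW (fun h => hPv (by rw [h]; rfl)) hPv hWv ?_
  refine exteriorPower.linearMap_ext (AlternatingMap.ext fun u => ?_)
  have hspan (x : Hyp R H) : y • x ∈ Submodule.span R (Set.range v) ⊔
      LinearMap.range (delta3 δ₂) := by
    rw [hf.smul_eq hy (by simpa using hn)]
    exact Submodule.add_mem_sup
      (Submodule.sum_mem _ fun j _ => Submodule.smul_mem _ _ (Submodule.subset_span ⟨j, rfl⟩))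
      (Submodule.sum_mem _ fun j _ => Submodule.smul_mem _ _ ⟨ψ j, rfl⟩)
  refine (alternatingMap_smul_eq_smul (fun x => ⟨y, hy, hspan x⟩)
    ((spinorP e s s).compAlternatingMap (exteriorPower.ιMulti R n))
    ((wedgePairing R H n a₃).compAlternatingMap (exteriorPower.ιMulti R n)) ?_
    (fun u i hi => ha.wedgePairing_eq_zero hB hnr hi) u).trans (mul_comm _ _)
  rintro u i ⟨φ, hφ⟩
  exact spinorP_eq_zero_of_spinorAct_eq_zero e i (hφ ▸ hs φ)

end Multiplier

section Rank

theorem finrank_range_baseChange {R M N : Type*} [CommRing R] [IsDomain R] [AddCommGroup M]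
    [Module R M] [AddCommGroup N] [Module R N] (f : M →ₗ[R] N) :
    Module.finrank (FractionRing R) (LinearMap.range (f.baseChange (FractionRing R))) =
      Module.finrank R (LinearMap.range f) := by
  let K := FractionRing R
  have hrange : LinearMap.range (f.baseChange K) =
      LinearMap.range ((LinearMap.range f).subtype.baseChange K) := by
    conv_lhs => rw [← LinearMap.subtype_comp_codRestrict f (LinearMap.range f) fun x => ⟨x, rfl⟩,
      LinearMap.baseChange_comp]
    refine LinearMap.range_comp_of_range_eq_top _ (LinearMap.range_eq_top.mpr ?_)
    exact LinearMap.lTensor_surjective K (g := f.rangeRestrict) f.surjective_rangeRestrict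
  have hinj : Function.Injective ((LinearMap.range f).subtype.baseChange K) :=
    Module.Flat.lTensor_preserves_injective_linearMap (M := K) (LinearMap.range f).subtype
      (LinearMap.range f).injective_subtype
  rw [hrange, LinearMap.finrank_range_of_inj hinj]
  exact (TensorProduct.isBaseChange R (LinearMap.range f) K).finrank_eq

theorem finrank_range_inf_ker_add_finrank_range_comp {K V V' W : Type*} [Field K] [AddCommGroup V]
    [Module K V] [AddCommGroup V'] [Module K V'] [AddCommGroup W] [Module K W] [Module.Finite K V']
    (f : V' →ₗ[K] V) (g : V →ₗ[K] W) :
    Module.finrank K (LinearMap.range f ⊓ LinearMap.ker g : Submodule K V) +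
      Module.finrank K (LinearMap.range (g ∘ₗ f)) = Module.finrank K (LinearMap.range f) := by
  have h := LinearMap.finrank_range_add_finrank_ker (g.domRestrict (LinearMap.range f))
  rw [LinearMap.range_domRestrict, ← LinearMap.range_comp] at h
  rw [← h, add_comm, LinearMap.ker_domRestrict, ← Submodule.map_comap_subtype,
    Submodule.finrank_map_subtype_eq]

end Rank

section PureSpinor

variable {R H : Type*} [CommRing R] [IsDomain R] [AddCommGroup H] [Module R H] [Module.Free R H]
  [Module.Finite R H]

theorem mem_VOdd_of_smul_mem {r : R} (hr : r ≠ 0) {s : ExteriorAlgebra R H}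
    (h : r • s ∈ VOdd R H) : s ∈ VOdd R H := by
  have := Module.Free.of_basis (Module.finBasis R H).ExteriorAlgebra
  have hcompl := CliffordAlgebra.evenOdd_isCompl (0 : QuadraticForm R H)
  obtain ⟨a, ha, b, hb, rfl⟩ := Submodule.mem_sup.mp
    (hcompl.sup_eq_top ▸ Submodule.mem_top : s ∈ VEven R H ⊔ VOdd R H)
  have ha0 : r • a = 0 := by
    refine Submodule.disjoint_def.mp hcompl.disjoint _ (Submodule.smul_mem _ _ ha) ?_
    simpa using Submodule.sub_mem _ h (Submodule.smul_mem _ r hb)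
  rwa [(smul_eq_zero.mp ha0).resolve_left hr, zero_add]

theorem actProd_one_ne_zero {k : ℕ} {l : Fin k → Hyp R H} (hl : ∀ i j, ⟪l i, l j⟫ = 0)
    (hli : LinearIndependent R fun i => (l i).2) : actProd (List.ofFn l) 1 ≠ 0 := by
  intro h
  have := Module.Free.of_basis (Module.finBasis R H).ExteriorAlgebra
  have hmod : LinIndepMod (0 : R) fun i => (l i).2 := fun c x hc i => by
    rw [zero_dvd_iff]
    exact Fintype.linearIndependent_iff.mp hli c (by simpa using hc) i
  obtain ⟨φ, y, hy, hφ⟩ := hmod.exists_dual (Or.inl rfl)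
  rw [zero_dvd_iff] at hy
  have hf : IsFrame (fun i => ((φ i, 0) : Hyp R H)) l y :=
    { left := fun i j => by simp only [dualProd_eq_add, map_zero, add_zero]
      right := hl
      pair := fun i j => by simp only [dualProd_eq_add, hφ, map_zero, add_zero, eq_comm] }
  refine one_ne_zero ((Submodule.mem_bot R).mp (hf.mem_of_actProd_mem (fun i s hs => ?_)
    (fun s hs => ?_) (fun i => ?_) (List.nodup_finRange _) ?_) : (1 : ExteriorAlgebra R H) = 0)
  · rw [(Submodule.mem_bot R).mp hs, map_zero]
    exact Submodule.zero_mem _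
  · exact (Submodule.mem_bot R).mpr ((smul_eq_zero.mp hs).resolve_left hy)
  · rw [spinorAct_inl, contr_one]
  · rwa [← List.ofFn_eq_map, Submodule.mem_bot]

variable {L : Submodule R (Hyp R H)} (hL : ∀ x ∈ L, ∀ z ∈ L, ⟪x, z⟫ = 0) [Invertible (2 : R)]

include hL

theorem spinorAct_actProd_one_eq_zero {l : List (Hyp R H)} (hl : ∀ x ∈ l, x ∈ L) {w u : Hyp R H}
    {r : R} (hr : r ≠ 0) (hw : w ∈ L) (hu : u ∈ Submodule.span R {x | x ∈ l})
    (hwu : (r • w - u).2 = 0) : spinorAct R H w (actProd l 1) = 0 := by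
  have := Module.Free.of_basis (Module.finBasis R H).ExteriorAlgebra
  have hkill : Submodule.span R {x | x ∈ l} ≤
      LinearMap.ker ((spinorAct R H).flip (actProd l 1)) := by
    rw [Submodule.span_le]
    exact fun x hx => spinorAct_actProd_eq_zero_of_mem hx
      (fun z hz => hL x (hl x hx) z (hl z hz)) 1
  have hdiff : spinorAct R H (r • w - u) (actProd l 1) = 0 := by
    refine spinorAct_actProd_eq_zero ?_ fun z hz => hL _ ?_ z (hl z hz)
    · rw [show r • w - u = ((r • w - u).1, 0) from Prod.ext rfl hwu, spinorAct_inl, contr_one]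
    · exact L.sub_mem (L.smul_mem r hw) (Submodule.span_le.mpr hl hu)
  rw [map_sub, map_smul, LinearMap.sub_apply, LinearMap.smul_apply,
    show spinorAct R H u (actProd l 1) = 0 from hkill hu, sub_zero] at hdiff
  exact (smul_eq_zero.mp hdiff).resolve_left hr

theorem exists_spinor_of_isotropic [Module.Finite R L] :
    ∃ s ∈ CliffordAlgebra.evenOdd (0 : QuadraticForm R H)
        (Module.finrank R (L.map (LinearMap.snd R (Module.Dual R H) H))),
      s ≠ 0 ∧ ∀ x ∈ L, spinorAct R H x s = 0 := by
  set P := L.map (LinearMap.snd R (Module.Dual R H) H)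
  have : Module.Finite R P := Module.Finite.map L _
  obtain ⟨z, hz⟩ := exists_linearIndependent_of_le_finrank (le_refl (Module.finrank R P))
  choose l hlL hlz using fun i => (z i).2
  have hl (x) (hx : x ∈ List.ofFn l) : x ∈ L := by
    obtain ⟨i, rfl⟩ := List.mem_ofFn.mp hx
    exact hlL i
  have hli : LinearIndependent R fun i => (l i).2 := by
    rw [show (fun i => (l i).2) = P.subtype ∘ z from funext hlz]
    exact hz.map' P.subtype P.ker_subtype
  refine ⟨actProd (List.ofFn l) 1, ?_,
    actProd_one_ne_zero (fun i j => hL _ (hlL i) _ (hlL j)) hli, fun w hw => ?_⟩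
  · simpa using actProd_mem_evenOdd (List.ofFn l) (i := 0)
      (CliffordAlgebra.one_le_evenOdd_zero _ (Submodule.one_le.mp le_rfl))
  · obtain ⟨r, hr, hrw⟩ := exists_smul_mem_of_finrank_le (Submodule.span R (Set.range z))
      (by rw [finrank_span_eq_card hz, Fintype.card_fin])
      ⟨w.2, Submodule.mem_map_of_mem (f := LinearMap.snd R (Module.Dual R H) H) hw⟩
    obtain ⟨c, hc⟩ := (Submodule.mem_span_range_iff_exists_fun R).mp hrw
    have hc : ∑ i, c i • (l i).2 = r • w.2 := by simpa [← hlz] using congrArg P.subtype hc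
    refine spinorAct_actProd_one_eq_zero hL hl hr hw (u := ∑ i, c i • l i)
      (Submodule.sum_mem _ fun i _ => Submodule.smul_mem _ _
        (Submodule.subset_span (List.mem_ofFn.mpr ⟨i, rfl⟩))) ?_
    simp [Prod.snd_sum, hc]

theorem exists_isPrimitive_VOdd_of_isotropic [WfDvdMonoid R] [Module.Finite R L]
    (hodd : Odd (Module.finrank R (L.map (LinearMap.snd R (Module.Dual R H) H)))) :
    ∃ s ∈ VOdd R H, s ≠ 0 ∧ IsPrimitive R s ∧ ∀ x ∈ L, spinorAct R H x s = 0 := by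
  have := Module.Free.of_basis (Module.finBasis R H).ExteriorAlgebra
  obtain ⟨s, hs, hs0, hLs⟩ := exists_spinor_of_isotropic hL
  rw [ZMod.natCast_eq_one_iff_odd.mpr hodd] at hs
  obtain ⟨r, s, rfl, hp⟩ := exists_eq_smul_isPrimitive (R := R) hs0
  obtain ⟨hr, hs0⟩ := smul_ne_zero_iff.mp hs0
  refine ⟨s, mem_VOdd_of_smul_mem hr hs, hs0, hp, fun x hx => ?_⟩
  have hrx := hLs x hx
  rw [map_smul] at hrx
  exact (smul_eq_zero.mp hrx).resolve_left hr

end PureSpinor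

section Resolution

variable {R B₀ B₁ H : Type*} [CommRing R] [IsDomain R]
  [AddCommGroup B₀] [Module R B₀] [Module.Free R B₀] [Module.Finite R B₀]
  [AddCommGroup B₁] [Module R B₁] [Module.Free R B₁] [Module.Finite R B₁]
  [AddCommGroup H] [Module R H] [Module.Free R H] [Module.Finite R H]
  {δ₁ : B₁ →ₗ[R] B₀} {δ₂ : Hyp R H →ₗ[R] B₁} {n : ℕ}

namespace IsSelfDualResolution

variable (hB : IsSelfDualResolution δ₁ δ₂)
  (hn : Module.finrank R B₁ = n + Module.finrank R B₀)

include hB hn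

theorem finrank_range_delta3 : Module.finrank R (LinearMap.range (delta3 δ₂)) = n := by
  have h := finrank_range_add_finrank_ker_of_isDomain (delta3 δ₂)
  rw [hB.exact₃.linearMap_ker_eq, LinearMap.finrank_range_of_inj hB.injective,
    Module.finrank_linearMap, Module.finrank_linearMap, Module.finrank_self, mul_one, mul_one] at h
  lia

variable (hcomp : DualInOtherComponent n δ₂)

include hcomp

theorem odd_finrank_map_snd : Odd (Module.finrank R
    ((LinearMap.range (delta3 δ₂)).map (LinearMap.snd R (Module.Dual R H) H))) := by
  have hex : Function.Exact ((LinearMap.inl R (Module.Dual R H) H).baseChange (FractionRing R))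
      ((LinearMap.snd R (Module.Dual R H) H).baseChange (FractionRing R)) :=
    lTensor_exact (FractionRing R)
      (LinearMap.exact_iff.mpr (LinearMap.range_inl R (Module.Dual R H) H).symm)
      LinearMap.snd_surjective
  have h := finrank_range_inf_ker_add_finrank_range_comp
    ((delta3 δ₂).baseChange (FractionRing R))
    ((LinearMap.snd R (Module.Dual R H) H).baseChange (FractionRing R))
  rw [← LinearMap.baseChange_comp, finrank_range_baseChange, finrank_range_baseChange,
    hB.finrank_range_delta3 hn, hex.linearMap_ker_eq, LinearMap.range_comp] at h
  rw [DualInOtherComponent, OppositeComponents, Nat.ModEq] at hcomp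
  rw [Nat.odd_iff]
  omega

theorem exists_isPrimitive_VOdd [Invertible (2 : R)] [WfDvdMonoid R] :
    ∃ s ∈ VOdd R H, s ≠ 0 ∧ IsPrimitive R s ∧
      ∀ φ, spinorAct R H (delta3 δ₂ φ) s = 0 := by
  obtain ⟨s, hs, hs0, hp, h⟩ := exists_isPrimitive_VOdd_of_isotropic
    (L := LinearMap.range (delta3 δ₂))
    (by rintro _ ⟨φ, rfl⟩ _ ⟨ψ, rfl⟩; exact hB.dualProd_delta3_delta3 φ ψ)
    (hB.odd_finrank_map_snd hn hcomp)
  exact ⟨s, hs, hs0, hp, fun φ => h _ ⟨φ, rfl⟩⟩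

end IsSelfDualResolution

end Resolution

section Components

variable {R H : Type*} [CommRing R] [AddCommGroup H] [Module R H]

theorem ιInv_algebraMap (r : R) :
    ExteriorAlgebra.ιInv (algebraMap R (ExteriorAlgebra R H) r) = 0 := by
  let : Module Rᵐᵒᵖ H := Module.compHom _ ((RingHom.id R).fromOpposite mul_comm)
  have : IsCentralScalar R H := ⟨fun r m => rfl⟩
  change (ExteriorAlgebra.toTrivSqZeroExt (algebraMap R (ExteriorAlgebra R H) r)).snd = 0
  rw [AlgHom.commutes]
  rfl

theorem fst_toTrivSqZeroExt [Module Rᵐᵒᵖ H] [IsCentralScalar R H] (s : ExteriorAlgebra R H) :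
    (ExteriorAlgebra.toTrivSqZeroExt s).fst = ExteriorAlgebra.algebraMapInv s := by
  have h : (TrivSqZeroExt.fstHom R R H).comp ExteriorAlgebra.toTrivSqZeroExt =
      ExteriorAlgebra.algebraMapInv := by
    refine ExteriorAlgebra.hom_ext (LinearMap.ext fun m => ?_)
    simp [ExteriorAlgebra.algebraMapInv, ExteriorAlgebra.toTrivSqZeroExt_ι]
  exact DFunLike.congr_fun h s

theorem ιInv_ι_mul (m : H) (s : ExteriorAlgebra R H) :
    ExteriorAlgebra.ιInv (ExteriorAlgebra.ι R m * s) = ExteriorAlgebra.algebraMapInv s • m := by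
  let : Module Rᵐᵒᵖ H := Module.compHom _ ((RingHom.id R).fromOpposite mul_comm)
  have : IsCentralScalar R H := ⟨fun r m => rfl⟩
  change (ExteriorAlgebra.toTrivSqZeroExt (ExteriorAlgebra.ι R m * s)).snd = _
  rw [map_mul, ExteriorAlgebra.toTrivSqZeroExt_ι, TrivSqZeroExt.snd_mul, TrivSqZeroExt.fst_inr,
    TrivSqZeroExt.snd_inr, zero_smul, zero_add, fst_toTrivSqZeroExt, op_smul_eq_smul]

theorem algebraMapInv_contr (d : Module.Dual R H) (s : ExteriorAlgebra R H) :
    ExteriorAlgebra.algebraMapInv (contr d s) = d (ExteriorAlgebra.ιInv s) := by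
  refine exteriorAlgebra_left_induction (N := LinearMap.eqLocus
    (ExteriorAlgebra.algebraMapInv.toLinearMap ∘ₗ contr d) (d ∘ₗ ExteriorAlgebra.ιInv)) ?_
    (fun m s _ => ?_) s
  · have h := ιInv_algebraMap (R := R) (H := H) 1
    rw [map_one] at h
    simp only [LinearMap.mem_eqLocus, LinearMap.comp_apply, contr_one, h, map_zero]
  · simp only [LinearMap.mem_eqLocus, LinearMap.comp_apply, AlgHom.toLinearMap_apply, contr_ι_mul,
      ιInv_ι_mul, map_sub, map_smul, algebraMapInv_ι_mul, sub_zero, smul_eq_mul, mul_comm]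

theorem algebraMapInv_contr_contr_ι_mul (d d' : Module.Dual R H) (m : H)
    (s : ExteriorAlgebra R H) :
    ExteriorAlgebra.algebraMapInv (contr d' (contr d (ExteriorAlgebra.ι R m * s))) =
      d m * d' (ExteriorAlgebra.ιInv s) - d' m * d (ExteriorAlgebra.ιInv s) := by
  rw [contr_ι_mul, map_sub, map_smul, contr_ι_mul, map_sub, map_sub, map_smul, map_smul,
    algebraMapInv_ι_mul, algebraMapInv_contr, algebraMapInv_contr, sub_zero, smul_eq_mul,
    smul_eq_mul]

theorem mul_ιInv_sub_mul_ιInv {x : Hyp R H} {s : ExteriorAlgebra R H}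
    (hs : spinorAct R H x s = 0) (d d' : Module.Dual R H) :
    d x.2 * d' (ExteriorAlgebra.ιInv s) - d' x.2 * d (ExteriorAlgebra.ιInv s) =
      -ExteriorAlgebra.algebraMapInv (contr d' (contr d (contr x.1 s))) := by
  have h : ExteriorAlgebra.ι R x.2 * s = -contr x.1 s := eq_neg_of_add_eq_zero_left hs
  rw [← algebraMapInv_contr_contr_ι_mul, h]
  simp only [map_neg]

end Components

section Lift

variable {R B₀ B₁ H : Type*} [CommRing R] [AddCommGroup B₀] [Module R B₀] [AddCommGroup B₁]
  [Module R B₁] [AddCommGroup H] [Module R H]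

theorem d₁_apply (a : VOdd R H) (f : Module.Dual R H) :
    d₁ a f = f (ExteriorAlgebra.ιInv (a : ExteriorAlgebra R H)) := rfl

theorem d₃_apply (δ₁ : B₁ →ₗ[R] B₀)
    (w : Module.Dual R (VEven R H) →ₗ[R] Module.Dual R B₁) (x : Module.Dual R B₀) (t : R) :
    d₃ δ₁ w (x, t) = delta4 δ₁ x + t • w (scalarFunctional R H) := by
  simp [d₃]

variable [Module.Free R H] [Module.Finite R H] {δ₁ : B₁ →ₗ[R] B₀} {δ₂ : Hyp R H →ₗ[R] B₁}
  {a : VOdd R H} {w : Module.Dual R (VEven R H) →ₗ[R] Module.Dual R B₁}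

theorem d₂_apply (φ : Module.Dual R B₁) : d₂ δ₂ φ = (delta3 δ₂ φ).1 := rfl

theorem dualProd_injective : Function.Injective (LinearMap.dualProd R H) :=
  LinearMap.ker_eq_bot.mp <| LinearMap.separatingLeft_iff_ker_eq_bot.mp <|
    (LinearMap.separatingLeft_dualProd (R := R) (M := H)).mpr
      (Module.evalEquiv R H).injective

theorem isSpinorLift_iff :
    IsSpinorLift δ₂ a w ↔ ∀ g, delta3 δ₂ (w g) = delta3 (actOn a) g := by
  have hdual (g) : (actOn a).dualMap g = LinearMap.dualProd R H (delta3 (actOn a) g) :=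
    LinearMap.ext fun x => (dualProd_delta3 (actOn a) g x).symm
  rw [IsSpinorLift, LinearMap.ext_iff]
  simp only [hdual, LinearMap.comp_apply, dualProd_injective.eq_iff]

theorem delta3_actOn_scalarFunctional (a : VOdd R H) :
    delta3 (actOn a) (scalarFunctional R H) =
      (0, ExteriorAlgebra.ιInv (a : ExteriorAlgebra R H)) := by
  refine dualProd_injective (LinearMap.ext fun x => ?_)
  rw [dualProd_delta3, dualProd_eq_add, LinearMap.zero_apply, zero_add, ← algebraMapInv_contr]
  change ExteriorAlgebra.algebraMapInv (spinorAct R H x a) = _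
  rw [spinorAct_apply, map_add, algebraMapInv_ι_mul, zero_add]

theorem IsSpinorLift.delta3_scalarFunctional (hw : IsSpinorLift δ₂ a w) :
    delta3 δ₂ (w (scalarFunctional R H)) =
      (0, ExteriorAlgebra.ιInv (a : ExteriorAlgebra R H)) := by
  rw [isSpinorLift_iff.mp hw, delta3_actOn_scalarFunctional]

theorem exists_isSpinorLift [Nontrivial R] [Module.Projective R B₁]
    (hB : IsSelfDualResolution δ₁ δ₂) (ha : ∀ φ, spinorAct R H (delta3 δ₂ φ) a = 0) :
    ∃ w, IsSpinorLift δ₂ a w := by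
  have := Module.Free.of_basis (Module.finBasis R H).ExteriorAlgebra
  have : Module.Projective R (VEven R H) := Module.Projective.of_split _ _
    (Submodule.projectionOnto_comp_subtype (CliffordAlgebra.evenOdd_isCompl 0))
  have := Module.Finite.of_basis (Module.finBasis R H).ExteriorAlgebra
  have : Module.Finite R (VEven R H) := Module.Finite.of_surjective _
    (Submodule.projectionOnto_surjective (CliffordAlgebra.evenOdd_isCompl 0))
  have hrange (g) : delta3 (actOn a) g ∈ LinearMap.range (delta3 δ₂) := by
    refine (hB.exact₂ _).mp ((Module.forall_dual_apply_eq_zero_iff R _).mp fun φ => ?_)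
    have hφ : actOn a (delta3 δ₂ φ) = 0 := Subtype.ext (ha φ)
    rw [← dualProd_delta3, dualProd_comm, dualProd_delta3, hφ, map_zero]
  obtain ⟨w, hw⟩ := Module.projective_lifting_property (delta3 δ₂).rangeRestrict
    ((delta3 (actOn a)).codRestrict _ hrange) (delta3 δ₂).surjective_rangeRestrict
  exact ⟨w, isSpinorLift_iff.mpr fun g => congrArg Subtype.val (LinearMap.congr_fun hw g)⟩

theorem d₂_comp_d₃ (hB : IsSelfDualResolution δ₁ δ₂) (hw : IsSpinorLift δ₂ a w) :
    d₂ δ₂ ∘ₗ d₃ δ₁ w = 0 := by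
  refine LinearMap.ext fun ⟨x, t⟩ => ?_
  rw [LinearMap.comp_apply, d₃_apply, d₂_apply, map_add, hB.delta3_delta4, map_smul,
    hw.delta3_scalarFunctional]
  simp

theorem d₁_comp_d₂ (ha : ∀ φ, spinorAct R H (delta3 δ₂ φ) a = 0) : d₁ a ∘ₗ d₂ δ₂ = 0 := by
  refine LinearMap.ext fun φ => ?_
  have h := congrArg ExteriorAlgebra.algebraMapInv (ha φ)
  rw [spinorAct_apply, map_add, algebraMapInv_ι_mul, map_zero, zero_add] at h
  rw [LinearMap.comp_apply, d₁_apply, d₂_apply, ← algebraMapInv_contr]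
  exact h

theorem d₃_injective [IsDomain R] (hB : IsSelfDualResolution δ₁ δ₂) (hw : IsSpinorLift δ₂ a w)
    (ha₁ : d₁ a ≠ 0) : Function.Injective (d₃ δ₁ w) := by
  rw [← LinearMap.ker_eq_bot, LinearMap.ker_eq_bot']
  rintro ⟨x, t⟩ h
  rw [d₃_apply] at h
  have h₃ := congrArg (delta3 δ₂) h
  rw [map_add, hB.delta3_delta4, map_smul, hw.delta3_scalarFunctional, zero_add, map_zero] at h₃
  have ha : ExteriorAlgebra.ιInv (a : ExteriorAlgebra R H) ≠ 0 := fun ha =>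
    ha₁ (LinearMap.ext fun f => (congrArg f ha).trans (map_zero f))
  obtain rfl : t = 0 := (smul_eq_zero.mp (congrArg Prod.snd h₃)).resolve_right ha
  rw [zero_smul, add_zero] at h
  rw [hB.injective (h.trans (map_zero _).symm), Prod.mk_zero_zero]

end Lift

section Coordinates

variable {R B₀ B₁ H : Type*} [CommRing R] [IsDomain R] [Invertible (2 : R)]
  [AddCommGroup B₀] [Module R B₀] [Module.Free R B₀] [Module.Finite R B₀]
  [AddCommGroup B₁] [Module R B₁] [Module.Free R B₁] [Module.Finite R B₁]
  [AddCommGroup H] [Module R H] [Module.Free R H] [Module.Finite R H]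
  {δ₁ : B₁ →ₗ[R] B₀} {δ₂ : Hyp R H →ₗ[R] B₁} {n r : ℕ}

theorem IsSpinorCoordinates.spinorAct_delta3_eq_zero {a : VOdd R H}
    (ha : IsSpinorCoordinates n r δ₁ δ₂ a) (hB : IsSelfDualResolution δ₁ δ₂)
    (hn : n + Module.finrank R B₀ ≤ Module.finrank R B₁) (φ : Module.Dual R B₁) :
    spinorAct R H (delta3 δ₂ φ) a = 0 := by
  obtain ⟨e, a₃, ε, ha₃, hP⟩ := ha
  obtain ⟨ψ, v, y, hf, hy, -⟩ := hB.exists_isFrame hn (Or.inl rfl)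
  rw [zero_dvd_iff] at hy
  refine hf.spinorAct_eq_zero hy (Module.finrank_eq_card_basis e) (fun i => ?_)
    fun i => hB.dualProd_delta3_delta3 _ _
  refine hf.spinorAct_eq_zero_of_spinorP_piecewise_eq_zero hy e i fun J hi => ?_
  rw [hP, LinearMap.smul_apply, ha₃.wedgePairing_eq_zero hB hn (i := i), smul_zero]
  exact ⟨ψ i, (J.piecewise_eq_of_mem (delta3 δ₂ ∘ ψ) v hi).symm⟩

theorem exists_isSpinorCoordinates [UniqueFactorizationMonoid R]
    (hB : IsSelfDualResolution δ₁ δ₂) (hH : Module.finrank R H = n)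
    (hr : Module.finrank R B₀ = r) (hn : Module.finrank R B₁ = n + r)
    (hcomp : DualInOtherComponent n δ₂) :
    ∃ a : VOdd R H, IsSpinorCoordinates n r δ₁ δ₂ a := by
  obtain ⟨s, hs, hs0, hp, hkill⟩ := hB.exists_isPrimitive_VOdd (hr ▸ hn) hcomp
  obtain ⟨a₃, ha₃⟩ := hB.exists_isMultiplier hH hr hn
  let e : Module.Basis (Fin n) R H := Module.finBasisOfFinrankEq R H hH
  obtain ⟨ε, hε⟩ := ha₃.exists_spinorP_eq_smul hB hH (hr ▸ hn.ge) e hs0 hp hkill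
  exact ⟨⟨s, hs⟩, e, a₃, ε, ha₃, hε⟩

end Coordinates

section GradeConditions

variable {R D : Type*} [CommRing R] [AddCommGroup D] [Module R D] {l μ : D →ₗ[R] R}

/-- `Hom(R/I, R/r) = 0` for all `r ≠ 0`; over a domain this holds as soon as `grade I ≥ 2`. -/
def CancelsDvd (I : Ideal R) : Prop := ∀ r x : R, r ≠ 0 → (∀ i ∈ I, r ∣ i * x) → r ∣ x

/-- `R/r → Hom(I, R/r)` is surjective for all `r ≠ 0`; over a domain this holds as soon as
`grade I ≥ 3`. -/
def ExtendsHom (I : Ideal R) : Prop :=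
  ∀ r : R, r ≠ 0 → ∀ φ : I →ₗ[R] R ⧸ Ideal.span {r}, ∃ ρ, ∀ i : I, φ i = (i : R) • ρ

theorem CancelsDvd.exists_eq_smul [IsDomain R] (h : CancelsDvd (LinearMap.range l)) (hl : l ≠ 0)
    (hμ : ∀ d d', μ d * l d' = μ d' * l d) : ∃ t : R, μ = t • l := by
  obtain ⟨d, hd⟩ := DFunLike.ne_iff.mp hl
  obtain ⟨t, ht⟩ := h (l d) (μ d) hd (by
    rintro _ ⟨d', rfl⟩
    exact ⟨μ d', by rw [mul_comm, hμ, mul_comm]⟩)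
  refine ⟨t, LinearMap.ext fun d' => mul_right_cancel₀ hd ?_⟩
  rw [← hμ, ht, LinearMap.smul_apply, smul_eq_mul]
  ring

theorem ExtendsHom.exists_dvd_sub_mul (he : ExtendsHom (LinearMap.range l))
    (hc : CancelsDvd (LinearMap.range l)) {r : R} (hr : r ≠ 0)
    (hμ : ∀ d d', r ∣ μ d * l d' - μ d' * l d) : ∃ ρ : R, ∀ d, r ∣ μ d - l d * ρ := by
  let μr : D →ₗ[R] R ⧸ Ideal.span {r} := (Ideal.span {r}).mkQ ∘ₗ μ
  have hker : LinearMap.ker l ≤ LinearMap.ker μr := by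
    intro d hd
    refine (Submodule.Quotient.mk_eq_zero _).mpr (Ideal.mem_span_singleton.mpr (hc r _ hr ?_))
    rintro _ ⟨d', rfl⟩
    have h := hμ d d'
    rwa [LinearMap.mem_ker.mp hd, mul_zero, sub_zero, mul_comm] at h
  obtain ⟨ρ, hρ⟩ := he r hr
    ((LinearMap.ker l).liftQ μr hker ∘ₗ l.quotKerEquivRange.symm.toLinearMap)
  obtain ⟨ρ, rfl⟩ := Ideal.Quotient.mk_surjective ρ
  refine ⟨ρ, fun d => Ideal.mem_span_singleton.mp ((Submodule.Quotient.eq _).mp ?_)⟩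
  have hd : l.quotKerEquivRange.symm ⟨l d, d, rfl⟩ = Submodule.Quotient.mk d :=
    l.quotKerEquivRange.symm_apply_eq.mpr rfl
  have h := hρ ⟨l d, d, rfl⟩
  rwa [LinearMap.comp_apply, LinearEquiv.coe_coe, hd, Submodule.liftQ_apply] at h

end GradeConditions

section Exactness

variable {R B₀ B₁ H : Type*} [CommRing R] [IsDomain R] [AddCommGroup B₀] [Module R B₀]
  [AddCommGroup B₁] [Module R B₁] [AddCommGroup H] [Module R H] [Module.Free R H]
  [Module.Finite R H] {δ₁ : B₁ →ₗ[R] B₀} {δ₂ : Hyp R H →ₗ[R] B₁} {a : VOdd R H}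
  {w : Module.Dual R (VEven R H) →ₗ[R] Module.Dual R B₁}

theorem exists_smul_mem_range_of_exact {F₁ F₂ F₃ : Type*} [AddCommGroup F₁] [Module R F₁]
    [Module.Finite R F₁] [AddCommGroup F₂] [Module R F₂] [Module.Free R F₂] [Module.Finite R F₂]
    [AddCommGroup F₃] [Module R F₃] {d₃ : F₃ →ₗ[R] F₂} {d₂ : F₂ →ₗ[R] F₁} {d₁ : F₁ →ₗ[R] R}
    (h₃ : Function.Injective d₃) (h₂ : Function.Exact d₃ d₂) (h₁ : d₁ ∘ₗ d₂ = 0) (hd₁ : d₁ ≠ 0)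
    (hrank : Module.finrank R F₂ + 1 = Module.finrank R F₁ + Module.finrank R F₃) {f : F₁}
    (hf : d₁ f = 0) : ∃ r : R, r ≠ 0 ∧ r • f ∈ LinearMap.range d₂ := by
  obtain ⟨f₀, hf₀⟩ := DFunLike.ne_iff.mp hd₁
  let g : F₂ × R →ₗ[R] F₁ := d₂.coprod (LinearMap.toSpanSingleton R F₁ f₀)
  have hd₁g (y c) : d₁ (g (y, c)) = c * d₁ f₀ := by
    have hy : d₁ (d₂ y) = 0 := LinearMap.congr_fun h₁ y
    simp [g, hy]
  have hc {y c} (h : d₁ (g (y, c)) = 0) : c = 0 :=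
    (mul_eq_zero.mp ((hd₁g y c).symm.trans h)).resolve_right hf₀
  have hker : LinearMap.ker g = LinearMap.range (LinearMap.inl R F₂ R ∘ₗ d₃) := by
    refine le_antisymm ?_ ?_
    · rintro ⟨y, c⟩ h
      obtain rfl := hc ((congrArg d₁ h).trans (map_zero _))
      obtain ⟨x, rfl⟩ := (h₂ y).mp (by simpa [g] using h)
      exact ⟨x, rfl⟩
    · rintro _ ⟨x, rfl⟩
      simp [g, h₂.apply_apply_eq_zero]
  have hg := finrank_range_add_finrank_ker_of_isDomain g
  rw [hker, LinearMap.finrank_range_of_inj (f := LinearMap.inl R F₂ R ∘ₗ d₃)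
    (LinearMap.inl_injective.comp h₃), Module.finrank_prod, Module.finrank_self] at hg
  obtain ⟨r, hr, ⟨y, c⟩, h⟩ := exists_smul_mem_of_finrank_le (LinearMap.range g) (by omega) f
  obtain rfl := hc (by rw [h, map_smul, hf, smul_zero])
  exact ⟨r, hr, y, by simpa [g] using h⟩

theorem exact_d₃_d₂ (hB : IsSelfDualResolution δ₁ δ₂) (hw : IsSpinorLift δ₂ a w)
    (ha : ∀ φ, spinorAct R H (delta3 δ₂ φ) a = 0) (ha₁ : d₁ a ≠ 0)
    (hc : CancelsDvd (idealI a)) : Function.Exact (d₃ δ₁ w) (d₂ δ₂) := by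
  rw [LinearMap.exact_iff]
  refine le_antisymm (fun φ hφ => ?_) (LinearMap.range_le_ker_iff.mpr (d₂_comp_d₃ hB hw))
  have hφ₁ : (delta3 δ₂ φ).1 = 0 := hφ
  obtain ⟨t, ht⟩ := hc.exists_eq_smul (μ := Module.Dual.eval R H (delta3 δ₂ φ).2) ha₁
    fun d d' => by
      have h := mul_ιInv_sub_mul_ιInv (ha φ) d d'
      simp only [hφ₁, map_zero, LinearMap.zero_apply, neg_zero] at h
      exact sub_eq_zero.mp h
  have hφ₂ : (delta3 δ₂ φ).2 = t • ExteriorAlgebra.ιInv (a : ExteriorAlgebra R H) :=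
    (Module.evalEquiv R H).injective (ht.trans (LinearMap.ext fun d => (map_smul d _ _).symm))
  obtain ⟨x, hx⟩ := (hB.exact₃ (φ - t • w (scalarFunctional R H))).mp (by
    rw [map_sub, map_smul, hw.delta3_scalarFunctional, sub_eq_zero]
    exact Prod.ext (by simpa using hφ₁) hφ₂)
  exact ⟨(x, t), by rw [d₃_apply, hx, sub_add_cancel]⟩

theorem mem_range_d₂_of_smul_mem [Module.IsTorsionFree R B₁]
    (hB : IsSelfDualResolution δ₁ δ₂) (hw : IsSpinorLift δ₂ a w)
    (ha : ∀ φ, spinorAct R H (delta3 δ₂ φ) a = 0) (hc : CancelsDvd (idealI a))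
    (he : ExtendsHom (idealI a)) {r : R} (hr : r ≠ 0) {f : Module.Dual R H}
    (hf : r • f ∈ LinearMap.range (d₂ δ₂)) : f ∈ LinearMap.range (d₂ δ₂) := by
  obtain ⟨φ, hφ⟩ := hf
  have hφ₁ : (delta3 δ₂ φ).1 = r • f := hφ
  obtain ⟨ρ, hρ⟩ := he.exists_dvd_sub_mul hc (μ := Module.Dual.eval R H (delta3 δ₂ φ).2) hr
    fun d d' => by
      have h := mul_ιInv_sub_mul_ιInv (ha φ) d d'
      simp only [hφ₁, map_smul, LinearMap.smul_apply, ← smul_neg] at h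
      exact ⟨_, h⟩
  obtain ⟨m, hm⟩ := exists_eq_smul_of_dvd_repr (Module.finBasis R H) (π := r)
    (z := (delta3 δ₂ φ).2 - ρ • ExteriorAlgebra.ιInv (a : ExteriorAlgebra R H)) fun i => by
      rw [← Module.Basis.coord_apply, map_sub, map_smul, smul_eq_mul, mul_comm]
      exact hρ ((Module.finBasis R H).coord i)
  obtain ⟨ψ, hψ⟩ := hB.exists_delta3_eq_of_smul (φ := φ - ρ • w (scalarFunctional R H))
    (z := (f, m)) hr (by
      rw [map_sub, map_smul, hw.delta3_scalarFunctional]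
      exact Prod.ext (by simpa using hφ₁) hm)
  exact ⟨ψ, congrArg Prod.fst hψ⟩

theorem exact_d₂_d₁ [Module.Free R B₀] [Module.Finite R B₀] [Module.Free R B₁]
    [Module.Finite R B₁] (hB : IsSelfDualResolution δ₁ δ₂) (hw : IsSpinorLift δ₂ a w)
    (ha : ∀ φ, spinorAct R H (delta3 δ₂ φ) a = 0) (ha₁ : d₁ a ≠ 0) (hc : CancelsDvd (idealI a))
    (he : ExtendsHom (idealI a))
    (hn : Module.finrank R B₁ = Module.finrank R H + Module.finrank R B₀) :
    Function.Exact (d₂ δ₂) (d₁ a) := by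
  rw [LinearMap.exact_iff]
  refine le_antisymm (fun f hf => ?_) (LinearMap.range_le_ker_iff.mpr (d₁_comp_d₂ ha))
  obtain ⟨r, hr, hrf⟩ := exists_smul_mem_range_of_exact (d₃_injective hB hw ha₁)
    (exact_d₃_d₂ hB hw ha ha₁ hc) (d₁_comp_d₂ ha) ha₁ (by
      simp only [Module.finrank_linearMap, Module.finrank_prod, Module.finrank_self, mul_one]
      omega) hf
  exact mem_range_d₂_of_smul_mem hB hw ha hc he hr hrf

end Exactness

section ExtVanishing

universe u

open CategoryTheory CategoryTheory.Abelian

variable {R : Type u} [CommRing R] {A B C X Y : Type u} [AddCommGroup A] [Module R A]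
  [AddCommGroup B] [Module R B] [AddCommGroup C] [Module R C] [AddCommGroup X] [Module R X]
  [AddCommGroup Y] [Module R Y] {f : A →ₗ[R] B} {g : B →ₗ[R] C}

variable (R X Y) in
/-- `Ext^i(X, Y) = 0`, stated for modules instead of objects of `ModuleCat R`. -/
def ExtVanishes (i : ℕ) : Prop :=
  Subsingleton (Ext.{u} (ModuleCat.of R X) (ModuleCat.of R Y) i)

theorem shortExact_of_exact (hf : Function.Injective f) (hfg : Function.Exact f g)
    (hg : Function.Surjective g) :
    (ModuleCat.shortComplexOfCompEqZero f g hfg.linearMap_comp_eq_zero).ShortExact :=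
  ModuleCat.shortComplex_shortExact _ hfg hf hg

theorem ExtVanishes.of_exact_right (hf : Function.Injective f) (hfg : Function.Exact f g)
    (hg : Function.Surjective g) {i : ℕ} (hB : ExtVanishes R X B i)
    (hA : ExtVanishes R X A (i + 1)) : ExtVanishes R X C i := by
  refine subsingleton_of_forall_eq 0 fun x => ?_
  obtain ⟨y, rfl⟩ := Ext.covariant_sequence_exact₃ (ModuleCat.of R X)
    (shortExact_of_exact hf hfg hg) x rfl (hA.elim _ _)
  rw [hB.elim y 0, Ext.zero_comp]

theorem ExtVanishes.of_exact_left [Module.Projective R B] (hf : Function.Injective f)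
    (hfg : Function.Exact f g) (hg : Function.Surjective g) {i : ℕ}
    (hC : ExtVanishes R C Y (i + 2)) : ExtVanishes R A Y (i + 1) := by
  refine subsingleton_of_forall_eq 0 fun x => ?_
  obtain ⟨y, rfl⟩ := Ext.contravariant_sequence_exact₁ (shortExact_of_exact hf hfg hg)
    (ModuleCat.of R Y) x (show 1 + (i + 1) = i + 2 by omega) (hC.elim _ _)
  have : Projective (ModuleCat.of R B) := ModuleCat.projective_of_categoryTheory_projective _
  rw [Ext.eq_zero_of_projective y, Ext.comp_zero]

theorem ExtVanishes.exists_comp_eq (hC : ExtVanishes R C Y 1) (hf : Function.Injective f)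
    (hfg : Function.Exact f g) (hg : Function.Surjective g) (φ : A →ₗ[R] Y) :
    ∃ ψ : B →ₗ[R] Y, ψ ∘ₗ f = φ := by
  obtain ⟨y, hy⟩ := Ext.contravariant_sequence_exact₁ (shortExact_of_exact hf hfg hg)
    (ModuleCat.of R Y) (Ext.mk₀ (ModuleCat.ofHom φ)) (show 1 + 0 = 1 from rfl) (hC.elim _ _)
  obtain ⟨ψ, rfl⟩ := (Ext.mk₀_bijective _ _).surjective y
  rw [Ext.mk₀_comp_mk₀] at hy
  exact ⟨ψ.hom, congrArg ModuleCat.Hom.hom ((Ext.mk₀_bijective _ _).injective hy)⟩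

theorem ExtVanishes.eq_zero_of_forall_smul_eq_zero {I : Ideal R} (h : ExtVanishes R (R ⧸ I) Y 0)
    {y : Y} (hy : ∀ i ∈ I, i • y = 0) : y = 0 := by
  let φ : (R ⧸ I) →ₗ[R] Y := I.liftQ (LinearMap.toSpanSingleton R Y y) hy
  have hφ : φ = 0 :=
    congrArg ModuleCat.Hom.hom ((Ext.mk₀_eq_zero_iff (ModuleCat.ofHom φ)).mp (h.elim _ _))
  calc y = φ (I.mkQ 1) := (one_smul R y).symm
    _ = 0 := by rw [hφ, LinearMap.zero_apply]

theorem ExtVanishes.quotient_span [IsDomain R] {i : ℕ} {r : R} (hr : r ≠ 0)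
    (h : ExtVanishes R X R i) (h' : ExtVanishes R X R (i + 1)) :
    ExtVanishes R X (R ⧸ Ideal.span {r}) i := by
  refine ExtVanishes.of_exact_right (f := LinearMap.mulLeft R r) (g := (Ideal.span {r}).mkQ)
    (mul_right_injective₀ hr) (fun x => ?_) (Submodule.mkQ_surjective _) h h'
  rw [Submodule.mkQ_apply, Submodule.Quotient.mk_eq_zero, Ideal.mem_span_singleton]
  exact ⟨fun ⟨y, hy⟩ => ⟨y, hy.symm⟩, fun ⟨y, hy⟩ => ⟨y, hy.symm⟩⟩

theorem exists_comp_eq_id_of_forall_dual [Module.Projective R A] [Module.Finite R A]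
    (h : ∀ φ : Module.Dual R A, ∃ ψ : Module.Dual R B, ψ ∘ₗ f = φ) :
    ∃ ρ : B →ₗ[R] A, ρ ∘ₗ f = LinearMap.id := by
  obtain ⟨k, p, hp⟩ := Module.Finite.exists_fin' R A
  obtain ⟨σ, hσ⟩ := Module.projective_lifting_property p LinearMap.id hp
  choose ψ hψ using fun i => h (LinearMap.proj i ∘ₗ σ)
  have hpi : LinearMap.pi ψ ∘ₗ f = σ :=
    LinearMap.ext fun x => funext fun i => LinearMap.congr_fun (hψ i) x
  exact ⟨p ∘ₗ LinearMap.pi ψ, by rw [LinearMap.comp_assoc, hpi, hσ]⟩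

theorem projective_of_exact [Module.Projective R A] [Module.Finite R A] [Module.Projective R B]
    (hf : Function.Injective f) (hfg : Function.Exact f g) (hg : Function.Surjective g)
    (hC : ExtVanishes R C R 1) : Module.Projective R C := by
  have hsplit : Function.Surjective g ∧ ∃ ρ, ρ ∘ₗ f = LinearMap.id :=
    ⟨hg, exists_comp_eq_id_of_forall_dual (hC.exists_comp_eq hf hfg hg)⟩
  obtain ⟨-, s, hs⟩ := (hfg.split_tfae'.out 1 0).mp hsplit
  exact Module.Projective.of_split s g hs

end ExtVanishing

section Grade

universe u

variable {R : Type u} [CommRing R] {I : Ideal R}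

theorem extVanishes_of_lt_grade {i : ℕ} (h : i < grade I) : ExtVanishes R (R ⧸ I) R i := by
  rw [ExtVanishes, ← not_nontrivial_iff_subsingleton]
  exact fun hi => h.not_ge (sInf_le (show (i : ℕ∞) ∈ {g : ℕ∞ | _} from ⟨i, rfl, hi⟩))

theorem ne_bot_of_extVanishes [Nontrivial R] (h : ExtVanishes R (R ⧸ I) R 0) : I ≠ ⊥ := by
  rintro rfl
  exact one_ne_zero (h.eq_zero_of_forall_smul_eq_zero (y := (1 : R)) fun i hi => by
    rw [(Submodule.mem_bot R).mp hi, zero_smul])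

theorem cancelsDvd_of_extVanishes [IsDomain R] (h0 : ExtVanishes R (R ⧸ I) R 0)
    (h1 : ExtVanishes R (R ⧸ I) R 1) : CancelsDvd I := by
  intro r x hr hx
  have h := (h0.quotient_span hr h1).eq_zero_of_forall_smul_eq_zero
    (y := Ideal.Quotient.mk (Ideal.span {r}) x) fun i hi =>
      Ideal.Quotient.eq_zero_iff_mem.mpr (Ideal.mem_span_singleton.mpr (hx i hi))
  rwa [Ideal.Quotient.eq_zero_iff_mem, Ideal.mem_span_singleton] at h

theorem extendsHom_of_extVanishes [IsDomain R] (h1 : ExtVanishes R (R ⧸ I) R 1)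
    (h2 : ExtVanishes R (R ⧸ I) R 2) : ExtendsHom I := by
  intro r hr φ
  obtain ⟨ψ, rfl⟩ := (h1.quotient_span hr h2).exists_comp_eq I.injective_subtype
    (LinearMap.exact_subtype_mkQ I) I.mkQ_surjective φ
  exact ⟨ψ 1, fun i => by rw [← map_smul, smul_eq_mul, mul_one]; rfl⟩

theorem eq_top_of_comp_subtype_eq_id [IsDomain R] (hI : I ≠ ⊥) {ρ : R →ₗ[R] I}
    (hρ : ρ ∘ₗ I.subtype = LinearMap.id) : I = ⊤ := by
  obtain ⟨i, hi, hi0⟩ := Submodule.exists_mem_ne_zero_of_ne_bot hI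
  have hρi : i • ρ 1 = ⟨i, hi⟩ := by
    rw [← map_smul, smul_eq_mul, mul_one]
    exact LinearMap.congr_fun hρ ⟨i, hi⟩
  have h : i * (ρ 1 : R) = i * 1 := (congrArg Subtype.val hρi).trans (mul_one i).symm
  rw [Ideal.eq_top_iff_one, ← mul_left_cancel₀ hi0 h]
  exact (ρ 1).2

theorem range_eq_top_of_extVanishes [IsDomain R] {F₁ F₂ F₃ : Type u} [AddCommGroup F₁]
    [Module R F₁] [Module.Projective R F₁] [Module.Finite R F₁] [AddCommGroup F₂] [Module R F₂]
    [Module.Projective R F₂] [Module.Finite R F₂] [AddCommGroup F₃] [Module R F₃]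
    [Module.Projective R F₃] [Module.Finite R F₃] {d₃ : F₃ →ₗ[R] F₂} {d₂ : F₂ →ₗ[R] F₁}
    {d₁ : F₁ →ₗ[R] R} (h₃ : Function.Injective d₃) (h₂ : Function.Exact d₃ d₂)
    (h₁ : Function.Exact d₂ d₁)
    (hExt : ∀ i ≤ 3, ExtVanishes R (R ⧸ (LinearMap.range d₁ : Ideal R)) R i) :
    LinearMap.range d₁ = ⊤ := by
  let I : Ideal R := LinearMap.range d₁
  have hI := LinearMap.exact_subtype_mkQ I
  have hI₁ : Function.Exact (LinearMap.range d₂).subtype d₁.rangeRestrict :=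
    h₁.linearMap_rangeRestrict
  have hExt₁ : ExtVanishes R I R 1 :=
    (hExt 2 (by norm_num)).of_exact_left I.injective_subtype hI I.mkQ_surjective
  have hExt₂ : ExtVanishes R I R 2 :=
    (hExt 3 le_rfl).of_exact_left I.injective_subtype hI I.mkQ_surjective
  have : Module.Projective R (LinearMap.range d₂) :=
    projective_of_exact h₃ ((LinearMap.range d₂).injective_subtype.comp_exact_iff_exact.mp h₂)
      d₂.surjective_rangeRestrict
      (hExt₂.of_exact_left (Submodule.injective_subtype _) hI₁ d₁.surjective_rangeRestrict)
  have : Module.Projective R I :=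
    projective_of_exact (Submodule.injective_subtype _) hI₁ d₁.surjective_rangeRestrict hExt₁
  have : Module.Finite R I := Module.Finite.range d₁
  obtain ⟨ρ, hρ⟩ := exists_comp_eq_id_of_forall_dual
    ((hExt 1 (by norm_num)).exists_comp_eq I.injective_subtype hI I.mkQ_surjective)
  exact eq_top_of_comp_subtype_eq_id (ne_bot_of_extVanishes (hExt 0 (by norm_num))) hρ

theorem range_eq_top_of_three_lt_grade [IsDomain R] {F₁ F₂ F₃ : Type*} [AddCommGroup F₁]
    [Module R F₁] [Module.Free R F₁] [Module.Finite R F₁] [AddCommGroup F₂] [Module R F₂]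
    [Module.Free R F₂] [Module.Finite R F₂] [AddCommGroup F₃] [Module R F₃] [Module.Free R F₃]
    [Module.Finite R F₃] {d₃ : F₃ →ₗ[R] F₂} {d₂ : F₂ →ₗ[R] F₁} {d₁ : F₁ →ₗ[R] R}
    (h₃ : Function.Injective d₃) (h₂ : Function.Exact d₃ d₂) (h₁ : Function.Exact d₂ d₁)
    (hgrade : 3 < grade (LinearMap.range d₁)) : LinearMap.range d₁ = ⊤ := by
  let e₁ := (Module.finBasis R F₁).equivFun
  let e₂ := (Module.finBasis R F₂).equivFun
  let e₃ := (Module.finBasis R F₃).equivFun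
  rw [← LinearEquiv.range_comp e₁.symm d₁] at hgrade ⊢
  refine range_eq_top_of_extVanishes (d₃ := (e₂.toLinearMap ∘ₗ d₃) ∘ₗ e₃.symm.toLinearMap)
    (d₂ := (e₁.toLinearMap ∘ₗ d₂) ∘ₗ e₂.symm.toLinearMap)
    ((e₂.injective.comp h₃).comp e₃.symm.injective) ?_ ?_ fun i hi =>
      extVanishes_of_lt_grade (hgrade.trans_le' (by exact_mod_cast hi))
  · rwa [LinearEquiv.precomp_exact_iff_exact, LinearEquiv.conj_exact_iff_exact,
      LinearEquiv.postcomp_exact_iff_exact]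
  · rwa [LinearEquiv.precomp_exact_iff_exact, LinearEquiv.conj_exact_iff_exact]

end Grade

section Acyclicity

variable {R B₀ B₁ H : Type*} [CommRing R] [IsDomain R]
  [AddCommGroup B₀] [Module R B₀] [Module.Free R B₀] [Module.Finite R B₀]
  [AddCommGroup B₁] [Module R B₁] [Module.Free R B₁] [Module.Finite R B₁]
  [AddCommGroup H] [Module R H] [Module.Free R H] [Module.Finite R H]
  {δ₁ : B₁ →ₗ[R] B₀} {δ₂ : Hyp R H →ₗ[R] B₁} {a : VOdd R H}
  {w : Module.Dual R (VEven R H) →ₗ[R] Module.Dual R B₁}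

theorem IsSpinorLift.exact_of_three_le_grade (hw : IsSpinorLift δ₂ a w)
    (hB : IsSelfDualResolution δ₁ δ₂)
    (hn : Module.finrank R B₁ = Module.finrank R H + Module.finrank R B₀)
    (ha : ∀ φ, spinorAct R H (delta3 δ₂ φ) a = 0) (hgrade : 3 ≤ grade (idealI a)) :
    Function.Injective (d₃ δ₁ w) ∧ Function.Exact (d₃ δ₁ w) (d₂ δ₂) ∧
      Function.Exact (d₂ δ₂) (d₁ a) := by
  have hExt (i : ℕ) (hi : i < 3) : ExtVanishes R (R ⧸ idealI a) R i :=
    extVanishes_of_lt_grade (hgrade.trans_lt' (by exact_mod_cast hi))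
  have ha₁ : d₁ a ≠ 0 := fun h =>
    ne_bot_of_extVanishes (hExt 0 (by norm_num)) (LinearMap.range_eq_bot.mpr h)
  have hc := cancelsDvd_of_extVanishes (hExt 0 (by norm_num)) (hExt 1 (by norm_num))
  have he := extendsHom_of_extVanishes (hExt 1 (by norm_num)) (hExt 2 (by norm_num))
  exact ⟨d₃_injective hB hw ha₁, exact_d₃_d₂ hB hw ha ha₁ hc,
    exact_d₂_d₁ hB hw ha ha₁ hc he hn⟩

end Acyclicity

end SpinorRes

end

open SpinorRes in
theorem mainTheorem3_general {R : Type*} [CommRing R] [IsDomain R] [UniqueFactorizationMonoid R]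
    [Invertible (2 : R)] {n r : ℕ} {B₀ B₁ H : Type*}
    [AddCommGroup B₀] [Module R B₀] [Module.Free R B₀] [Module.Finite R B₀]
    [AddCommGroup B₁] [Module R B₁] [Module.Free R B₁] [Module.Finite R B₁]
    [AddCommGroup H] [Module R H] [Module.Free R H] [Module.Finite R H]
    (hB₀ : Module.finrank R B₀ = r) (hB₁ : Module.finrank R B₁ = n + r)
    (hH : Module.finrank R H = n) {δ₁ : B₁ →ₗ[R] B₀} {δ₂ : Hyp R H →ₗ[R] B₁}
    (hB : IsSelfDualResolution δ₁ δ₂) (hcomp : DualInOtherComponent n δ₂) :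
    (∃ a : VOdd R H, IsSpinorCoordinates n r δ₁ δ₂ a) ∧
    ∀ a : VOdd R H, IsSpinorCoordinates n r δ₁ δ₂ a →
      (∃ w : Module.Dual R (VEven R H) →ₗ[R] Module.Dual R B₁, IsSpinorLift δ₂ a w) ∧
      ∀ w : Module.Dual R (VEven R H) →ₗ[R] Module.Dual R B₁, IsSpinorLift δ₂ a w →
        (d₂ δ₂ ∘ₗ d₃ δ₁ w = 0 ∧ d₁ a ∘ₗ d₂ δ₂ = 0) ∧
        (3 ≤ grade (idealI a) →
          (Function.Injective (d₃ δ₁ w) ∧ Function.Exact (d₃ δ₁ w) (d₂ δ₂) ∧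
            Function.Exact (d₂ δ₂) (d₁ a)) ∧
          (grade (idealI a) = 3 ∨ idealI a = ⊤)) := by
  refine ⟨exists_isSpinorCoordinates hB hH hB₀ hB₁ hcomp, fun a ha => ?_⟩
  have hkill := ha.spinorAct_delta3_eq_zero hB (hB₀ ▸ hB₁.ge)
  refine ⟨exists_isSpinorLift hB hkill, fun w hw =>
    ⟨⟨d₂_comp_d₃ hB hw, d₁_comp_d₂ hkill⟩, fun hgrade => ?_⟩⟩
  have hexact := hw.exact_of_three_le_grade hB (by omega) hkill hgrade
  exact ⟨hexact, hgrade.eq_or_lt.imp Eq.symm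
    (range_eq_top_of_three_lt_grade hexact.1 hexact.2.1 hexact.2.2)⟩

open SpinorRes in
theorem mainTheorem3 {R : Type*} [CommRing R] [IsDomain R] [UniqueFactorizationMonoid R]
    [IsNoetherianRing R] [Invertible (2 : R)]
    (p q : ℕ) (hp : 1 ≤ p) (hq : 3 ≤ q)
    {B₀ B₁ H : Type*}
    [AddCommGroup B₀] [Module R B₀] [Module.Free R B₀] [Module.Finite R B₀]
    [AddCommGroup B₁] [Module R B₁] [Module.Free R B₁] [Module.Finite R B₁]
    [AddCommGroup H] [Module R H] [Module.Free R H] [Module.Finite R H]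
    (hB₀ : Module.finrank R B₀ = q - 2) (hB₁ : Module.finrank R B₁ = p + q)
    (hH : Module.finrank R H = p + 2)
    (δ₁ : B₁ →ₗ[R] B₀) (δ₂ : Hyp R H →ₗ[R] B₁)
    (hB : IsSelfDualResolution δ₁ δ₂)
    (hcomp : DualInOtherComponent (p + 2) δ₂) :
    (∃ a : VOdd R H, IsSpinorCoordinates (p + 2) (q - 2) δ₁ δ₂ a) ∧
    ∀ a : VOdd R H, IsSpinorCoordinates (p + 2) (q - 2) δ₁ δ₂ a →
      (∃ w : Module.Dual R (VEven R H) →ₗ[R] Module.Dual R B₁, IsSpinorLift δ₂ a w) ∧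
      ∀ w : Module.Dual R (VEven R H) →ₗ[R] Module.Dual R B₁, IsSpinorLift δ₂ a w →
        (d₂ δ₂ ∘ₗ d₃ δ₁ w = 0 ∧ d₁ a ∘ₗ d₂ δ₂ = 0) ∧
        (3 ≤ grade (idealI a) →
          (Function.Injective (d₃ δ₁ w) ∧ Function.Exact (d₃ δ₁ w) (d₂ δ₂) ∧
            Function.Exact (d₂ δ₂) (d₁ a)) ∧
          (grade (idealI a) = 3 ∨ idealI a = ⊤)) :=
  mainTheorem3_general hB₀ (by omega) hH hB hcomp
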